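/- Write $\mathbb R^+=[0,\infty)$. Let $\psi$ be a non-negative, continuous function on $[0,1]$ and let $\omega_1,\omega_2$ be positive, continuous functions on $\mathbb R^+$. Assume condition (C): there is a constant $C$ such that $$\int_0^1\omega_2(s/t)\,\frac{\psi(t)}{t}\,dt\le C\,\omega_1(s)\qquad\text{for every } s\in\mathbb R^+ .$$ For a positive, continuous function $\omega$ on $\mathbb R^+$ let $L^1(\omega)$ be the space of (classes of) measurable $f:\mathbb R^+\to\mathbb C$ with $\|f\|=\int_0^\infty|f|\,\omega\,dx<\infty$, let $C_0(1/\omega)$ be the space of continuous $g:\mathbb R^+\to\mathbb C$ for which $g/\omega$ vanishes at infinity, with norm $\sup|g|/\omega$, and let $M(\mathbb R^+,\omega)$ be the space of locally finite complex Borel measures $\mu$ on $\mathbb R^+$ with $\|\mu\|=\int_{\mathbb R^+}\omega\,d|\mu|<\infty$. A function $f\in L^1(\omega)$ is identified with the measure $f(x)\,dx\in M(\mathbb R^+,\omega)$. Then $(U_\psi f)(x)=\int_0^1 f(tx)\psi(t)\,dt$ (the integral converging absolutely for almost all $x$) defines a bounded operator $U_\psi:L^1(\omega_1)\to L^1(\omega_2)$;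 its adjoint restricts to a bounded operator $V_\psi:C_0(1/\omega_2)\to C_0(1/\omega_1)$, i.e. there is a unique bounded operator $V_\psi$ with $\int_0^\infty (U_\psi f)\,g\,dx=\int_0^\infty f\,(V_\psi g)\,dx$ for all $f\in L^1(\omega_1)$ and $g\in C_0(1/\omega_2)$; and $V_\psi$ has an adjoint $\overline U_\psi=V_\psi^*$, i.e. there is a unique bounded operator $\overline U_\psi:M(\mathbb R^+,\omega_1)\to M(\mathbb R^+,\omega_2)$ with $\int g\,d(\overline U_\psi\mu)=\int V_\psi g\,d\mu$ for all $\mu\in M(\mathbb R^+,\omega_1)$ and $g\in C_0(1/\omega_2)$. For every $\mu\in M(\mathbb R^+,\omega_1)$ the function $$(W_\psi\mu)(x)=\frac1x\int_{(0,x)}\psi(s/x)\,d\mu(s)\qquad(x>0)$$ belongs to $L^1(\omega_2)$, and $$\overline U_\psi\mu=W_\psi\mu+\Big(\int_0^1\frac{\psi(t)}{t}\,dt\Big)\,\mu(\{0\})\,\delta_0 .$$ In particular the range of $\overline U_\psi$ lies in the direct sum $L^1(\omega_2)\oplus\mathbb C\delta_0$, and $\overline U_\psi$ maps every $\mu\in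 M(\mathbb R^+,\omega_1)$ with $\mu(\{0\})=0$ (that is, every $\mu \in M((0,\infty),\omega_1)$) into $L^1(\omega_2)$. -/

import Mathlib

open MeasureTheory Set Filter Topology
open scoped NNReal ENNReal

namespace HardyCesaro

noncomputable section

/-! Throughout, the half-line `[0, ∞)` is the type `ℝ≥0`. -/

/-- Lebesgue measure on `[0, ∞)`. -/
def leb : Measure ℝ≥0 := Measure.comap ((↑) : ℝ≥0 → ℝ) volume

/-- A weight: a positive, continuous function on `[0, ∞)`. -/
structure Weight where
  toFun : ℝ≥0 → ℝ
  continuous_toFun : Continuous toFun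
  pos : ∀ x, 0 < toFun x

instance : CoeFun Weight (fun _ => ℝ≥0 → ℝ) := ⟨Weight.toFun⟩

lemma Weight.continuous (ω : Weight) : Continuous (ω : ℝ≥0 → ℝ) := ω.continuous_toFun

/-- The weight as a function with values in `[0, ∞]`. -/
def Weight.ennreal (ω : Weight) (x : ℝ≥0) : ℝ≥0∞ := ENNReal.ofReal (ω x)

lemma Weight.measurable_ennreal (ω : Weight) : Measurable ω.ennreal :=
  ω.continuous.measurable.ennreal_ofReal

lemma Weight.ennreal_ne_zero (ω : Weight) (x : ℝ≥0) : ω.ennreal x ≠ 0 := by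
  simpa [Weight.ennreal] using ω.pos x

lemma Weight.ennreal_ne_top (ω : Weight) (x : ℝ≥0) : ω.ennreal x ≠ ∞ := by
  simp [Weight.ennreal]

/-- The measure `ω(x) dx` on `[0, ∞)`. -/
def Weight.measure (ω : Weight) : Measure ℝ≥0 := leb.withDensity ω.ennreal

/-- The Banach space `L¹(ω)`, with norm `∫ |f| ω dx`. -/
abbrev L1w (ω : Weight) : Type := Lp ℂ 1 ω.measure

/-! ### The space of continuous functions `g` with `g / ω` vanishing at infinity -/

/-- The continuous functions `g` on `[0, ∞)` for which `g / ω` vanishes at infinity, as a linear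
subspace of the space of all functions. -/
def c0Submodule (ω : Weight) : Submodule ℂ (ℝ≥0 → ℂ) where
  carrier := {g | Continuous g ∧ Tendsto (fun x => g x / (ω x : ℂ)) (cocompact ℝ≥0) (𝓝 0)}
  zero_mem' := ⟨continuous_zero, by simp⟩
  add_mem' := by
    rintro f g ⟨hf, hf'⟩ ⟨hg, hg'⟩
    refine ⟨hf.add hg, ?_⟩
    simpa [add_div] using hf'.add hg'
  smul_mem' := by
    rintro c g ⟨hg, hg'⟩
    refine ⟨hg.const_smul c, ?_⟩
    simpa [mul_div_assoc] using hg'.const_mul c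

/-- The space `C₀(1/ω)`. -/
def C0w (ω : Weight) : Type := c0Submodule ω

instance (ω : Weight) : AddCommGroup (C0w ω) := inferInstanceAs (AddCommGroup (c0Submodule ω))
instance (ω : Weight) : Module ℂ (C0w ω) := inferInstanceAs (Module ℂ (c0Submodule ω))
instance (ω : Weight) : CoeFun (C0w ω) (fun _ => ℝ≥0 → ℂ) := ⟨fun g => g.1⟩

/-- The linear map `g ↦ g / ω` from `C₀(1/ω)` to `C₀([0, ∞))`. -/
def C0w.divWeight (ω : Weight) : C0w ω →ₗ[ℂ] ZeroAtInftyContinuousMap ℝ≥0 ℂ where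
  toFun g :=
    { toFun := fun x => g x / (ω x : ℂ)
      continuous_toFun := g.2.1.div (Complex.continuous_ofReal.comp ω.continuous)
        (fun x => by exact_mod_cast (ω.pos x).ne')
      zero_at_infty' := g.2.2 }
  map_add' f g := by
    ext x
    exact add_div _ _ _
  map_smul' c g := by
    ext x
    exact mul_div_assoc _ _ _

lemma C0w.divWeight_injective (ω : Weight) : Function.Injective (C0w.divWeight ω) := by
  intro f g h
  refine Subtype.ext (funext fun x => ?_)
  have hx : f x / (ω x : ℂ) = g x / (ω x : ℂ) := DFunLike.congr_fun h x
  have h0 : (ω x : ℂ) ≠ 0 := by exact_mod_cast (ω.pos x).ne'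
  exact (div_left_inj' h0).1 hx

/-- The norm of `C₀(1/ω)` is `‖g‖ = sup |g| / ω`. -/
instance (ω : Weight) : NormedAddCommGroup (C0w ω) :=
  NormedAddCommGroup.induced _ _ (C0w.divWeight ω) (C0w.divWeight_injective ω)

instance (ω : Weight) : NormedSpace ℂ (C0w ω) :=
  NormedSpace.induced ℂ _ _ (C0w.divWeight ω)

/-! ### Locally finite complex Borel measures on `[0, ∞)` -/

/-- A locally finite complex Borel measure on `[0, ∞)`: a countably additive complex-valued function
on the bounded Borel sets. As for vector measures in Mathlib, the set function gets the value `0` on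
the sets where it is not meant to be evaluated. -/
@[ext]
structure LocComplexMeasure where
  toFun : Set ℝ≥0 → ℂ
  eq_zero' : ∀ E, ¬ (MeasurableSet E ∧ Bornology.IsBounded E) → toFun E = 0
  hasSum_iUnion' : ∀ E : ℕ → Set ℝ≥0, (∀ i, MeasurableSet (E i)) →
    Pairwise (Function.onFun Disjoint E) → Bornology.IsBounded (⋃ i, E i) →
    HasSum (fun i => toFun (E i)) (toFun (⋃ i, E i))

namespace LocComplexMeasure

instance : CoeFun LocComplexMeasure (fun _ => Set ℝ≥0 → ℂ) := ⟨toFun⟩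

lemma toFun_injective : Function.Injective toFun := fun _ _ h => LocComplexMeasure.ext h

instance : Zero LocComplexMeasure :=
  ⟨⟨0, fun _ _ => rfl, fun _ _ _ _ => hasSum_zero⟩⟩

instance : Add LocComplexMeasure :=
  ⟨fun μ ν => ⟨μ.toFun + ν.toFun, fun E hE => by simp [μ.eq_zero' E hE, ν.eq_zero' E hE],
    fun E h₁ h₂ h₃ => (μ.hasSum_iUnion' E h₁ h₂ h₃).add (ν.hasSum_iUnion' E h₁ h₂ h₃)⟩⟩

instance : Neg LocComplexMeasure :=
  ⟨fun μ => ⟨-μ.toFun, fun E hE => by simp [μ.eq_zero' E hE],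
    fun E h₁ h₂ h₃ => (μ.hasSum_iUnion' E h₁ h₂ h₃).neg⟩⟩

instance : Sub LocComplexMeasure :=
  ⟨fun μ ν => ⟨μ.toFun - ν.toFun, fun E hE => by simp [μ.eq_zero' E hE, ν.eq_zero' E hE],
    fun E h₁ h₂ h₃ => (μ.hasSum_iUnion' E h₁ h₂ h₃).sub (ν.hasSum_iUnion' E h₁ h₂ h₃)⟩⟩

/-- Multiplication of a measure by a scalar (of `ℕ`, `ℤ` or `ℂ`), setwise. -/
instance {R : Type*} [Monoid R] [DistribMulAction R ℂ] [ContinuousConstSMul R ℂ] :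
    SMul R LocComplexMeasure :=
  ⟨fun c μ => ⟨c • μ.toFun, fun E hE => by simp [μ.eq_zero' E hE],
    fun E h₁ h₂ h₃ => (μ.hasSum_iUnion' E h₁ h₂ h₃).const_smul c⟩⟩

instance : AddCommGroup LocComplexMeasure :=
  toFun_injective.addCommGroup _ rfl (fun _ _ => rfl) (fun _ => rfl) (fun _ _ => rfl)
    (fun _ _ => rfl) (fun _ _ => rfl)

/-- Evaluation, as an additive map. -/
def toFunHom : LocComplexMeasure →+ (Set ℝ≥0 → ℂ) where
  toFun := toFun
  map_zero' := rfl
  map_add' _ _ := rfl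

instance : Module ℂ LocComplexMeasure :=
  toFun_injective.module ℂ toFunHom (fun _ _ => rfl)

lemma empty (μ : LocComplexMeasure) : μ ∅ = 0 := by
  have h := μ.hasSum_iUnion' (fun _ => ∅) (fun _ => MeasurableSet.empty)
    (fun _ _ _ => disjoint_bot_left) (by simp)
  simpa using h.summable.tendsto_atTop_zero

/-- The finite complex measure `E ↦ μ (E ∩ K)`, for a bounded Borel set `K`. -/
def restrict (μ : LocComplexMeasure) (K : Set ℝ≥0) (hK : MeasurableSet K)
    (hb : Bornology.IsBounded K) : ComplexMeasure ℝ≥0 where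
  measureOf' E := open Classical in if MeasurableSet E then μ (E ∩ K) else 0
  empty' := by simp [μ.empty]
  not_measurable' E hE := by simp [hE]
  m_iUnion' E hE hd := by
    have h := μ.hasSum_iUnion' (fun i => E i ∩ K) (fun i => (hE i).inter hK)
      (fun i j hij => (hd hij).mono inter_subset_left inter_subset_left)
      (hb.subset (by simp))
    simpa [hE, MeasurableSet.iUnion hE, iUnion_inter] using h

/-- The restriction of `μ` to the interval `[n, n + 1)`. -/
def piece (μ : LocComplexMeasure) (n : ℕ) : ComplexMeasure ℝ≥0 :=
  μ.restrict (Ico (n : ℝ≥0) (n + 1)) measurableSet_Ico (Metric.isBounded_Ico _ _)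

/-- The total variation `|μ|` of `μ`, put together from the total variations of the restrictions
of `μ` to the disjoint intervals `[n, n + 1)`. -/
def variation (μ : LocComplexMeasure) : Measure ℝ≥0 :=
  Measure.sum fun n => (μ.piece n).variation

/-- The integral `∫ g dμ` over `[0, ∞)` (for `g` integrable with respect to `|μ|`), put together
from the integrals over the disjoint intervals `[n, n + 1)`. -/
def integral (μ : LocComplexMeasure) (g : ℝ≥0 → ℂ) : ℂ :=
  ∑' n, ∫ᵛ x, g x ∂[ContinuousLinearMap.mul ℝ ℂ; μ.piece n]

lemma piece_add (μ ν : LocComplexMeasure) (n : ℕ) : (μ + ν).piece n = μ.piece n + ν.piece n := by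
  ext E hE
  simp [piece, restrict, hE]
  rfl

lemma piece_smul (c : ℂ) (μ : LocComplexMeasure) (n : ℕ) : (c • μ).piece n = c • μ.piece n := by
  ext E hE
  simp [piece, restrict, hE]
  rfl

lemma variation_zero : (0 : LocComplexMeasure).variation = 0 := by
  have h (n : ℕ) : (0 : LocComplexMeasure).piece n = 0 := by
    ext E hE
    simp [piece, restrict, hE]
    rfl
  simp [variation, h]

lemma variation_add_le (μ ν : LocComplexMeasure) :
    (μ + ν).variation ≤ μ.variation + ν.variation := by
  rw [variation, variation, variation, Measure.sum_add_sum]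
  refine Measure.le_iff.2 fun E hE => ?_
  rw [Measure.sum_apply _ hE, Measure.sum_apply _ hE]
  refine ENNReal.tsum_le_tsum fun n => ?_
  rw [piece_add]
  exact VectorMeasure.variation_add_le E

lemma variation_smul (c : ℂ) (μ : LocComplexMeasure) :
    (c • μ).variation = (‖c‖₊ : ℝ≥0∞) • μ.variation := by
  ext E hE
  rw [variation, variation, Measure.smul_apply, Measure.sum_apply _ hE, Measure.sum_apply _ hE,
    smul_eq_mul, ← ENNReal.tsum_mul_left]
  refine tsum_congr fun n => ?_
  rw [piece_smul, VectorMeasure.variation_smul]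
  rfl

/-- The extended norm `∫ ω d|μ|`. -/
def weightedMass (ω : Weight) (μ : LocComplexMeasure) : ℝ≥0∞ := ∫⁻ x, ω.ennreal x ∂μ.variation

lemma weightedMass_add_le (ω : Weight) (μ ν : LocComplexMeasure) :
    weightedMass ω (μ + ν) ≤ weightedMass ω μ + weightedMass ω ν := by
  rw [weightedMass, weightedMass, weightedMass, ← lintegral_add_measure]
  exact lintegral_mono' (variation_add_le μ ν) le_rfl

lemma weightedMass_smul (ω : Weight) (c : ℂ) (μ : LocComplexMeasure) :
    weightedMass ω (c • μ) = ‖c‖₊ * weightedMass ω μ := by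
  rw [weightedMass, weightedMass, variation_smul, lintegral_smul_measure, smul_eq_mul]

lemma eq_zero_of_weightedMass (ω : Weight) (μ : LocComplexMeasure) (h : weightedMass ω μ = 0) :
    μ = 0 := by
  have hv : μ.variation = 0 := by
    rw [weightedMass, lintegral_eq_zero_iff ω.measurable_ennreal] at h
    rw [← ae_eq_bot]
    by_contra hne
    have : (ae μ.variation).NeBot := ⟨hne⟩
    obtain ⟨x, hx⟩ := h.exists
    exact ω.ennreal_ne_zero x hx
  have hp (n : ℕ) : μ.piece n = 0 := by
    rw [← VectorMeasure.variation_eq_zero]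
    exact (Measure.sum_eq_zero.1 hv) n
  refine LocComplexMeasure.ext (funext fun E => ?_)
  change μ E = 0
  by_cases hE : MeasurableSet E ∧ Bornology.IsBounded E
  swap
  · exact μ.eq_zero' E hE
  have hU : (⋃ n : ℕ, E ∩ Ico (n : ℝ≥0) (n + 1)) = E := by
    rw [← inter_iUnion]
    refine inter_eq_left.2 fun x _ => mem_iUnion.2 ⟨⌊x⌋₊, Nat.floor_le x.2, Nat.lt_floor_add_one x⟩
  have hd : Pairwise (Function.onFun Disjoint fun n : ℕ => E ∩ Ico (n : ℝ≥0) (n + 1)) := by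
    intro m n hmn
    refine disjoint_left.2 fun x hx hx' => hmn ?_
    have h₁ := (Nat.floor_eq_iff x.2).2 ⟨hx.2.1, hx.2.2⟩
    have h₂ := (Nat.floor_eq_iff x.2).2 ⟨hx'.2.1, hx'.2.2⟩
    exact h₁.symm.trans h₂
  have hs := μ.hasSum_iUnion' (fun n : ℕ => E ∩ Ico (n : ℝ≥0) (n + 1))
    (fun n => hE.1.inter measurableSet_Ico) hd (by rw [hU]; exact hE.2)
  rw [hU] at hs
  have h0 (n : ℕ) : μ (E ∩ Ico (n : ℝ≥0) (n + 1)) = 0 := by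
    have := congrArg (fun ν : ComplexMeasure ℝ≥0 => ν E) (hp n)
    simpa [piece, restrict, hE.1] using this
  simp only [h0] at hs
  exact hs.unique hasSum_zero

lemma variation_le (μ : LocComplexMeasure) (m : Measure ℝ≥0)
    (h : ∀ E, MeasurableSet E → Bornology.IsBounded E → ‖μ E‖ₑ ≤ m E) : μ.variation ≤ m := by
  have hU : (⋃ n : ℕ, Ico (n : ℝ≥0) (n + 1)) = univ :=
    eq_univ_of_forall fun x => mem_iUnion.2 ⟨⌊x⌋₊, Nat.floor_le x.2, Nat.lt_floor_add_one x⟩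
  have hd : Pairwise (Function.onFun Disjoint fun n : ℕ => Ico (n : ℝ≥0) (n + 1)) := by
    intro m n hmn
    refine disjoint_left.2 fun x hx hx' => hmn ?_
    have h₁ := (Nat.floor_eq_iff x.2).2 ⟨hx.1, hx.2⟩
    have h₂ := (Nat.floor_eq_iff x.2).2 ⟨hx'.1, hx'.2⟩
    exact h₁.symm.trans h₂
  have hm : m = Measure.sum fun n : ℕ => m.restrict (Ico (n : ℝ≥0) (n + 1)) := by
    rw [← Measure.restrict_iUnion hd (fun n => measurableSet_Ico), hU, Measure.restrict_univ]
  rw [hm]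
  refine Measure.le_iff.2 fun E hE => ?_
  rw [variation, Measure.sum_apply _ hE, Measure.sum_apply _ hE]
  refine ENNReal.tsum_le_tsum fun n => ?_
  refine VectorMeasure.variation_le_of_forall_enorm_le (fun F hF => ?_) E
  rw [Measure.restrict_apply hF]
  have := h (F ∩ Ico (n : ℝ≥0) (n + 1)) (hF.inter measurableSet_Ico)
    ((Metric.isBounded_Ico _ _).subset inter_subset_right)
  simpa [piece, restrict, hF] using this

/-- The unit point mass `δ_a`. -/
def dirac (a : ℝ≥0) : LocComplexMeasure where
  toFun E := open Classical in
    if MeasurableSet E ∧ Bornology.IsBounded E then E.indicator (fun _ => (1 : ℂ)) a else 0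
  eq_zero' E hE := by simp [hE]
  hasSum_iUnion' E hE hd hb := by
    have hb' (i : ℕ) : Bornology.IsBounded (E i) := hb.subset (subset_iUnion E i)
    have := (VectorMeasure.dirac a (1 : ℂ)).m_iUnion hE hd
    simp only [hE, hb', hb, MeasurableSet.iUnion hE, and_self, if_true]
    convert this using 2 with i
    · by_cases ha : a ∈ E i <;> simp [hE, ha]
    · by_cases ha : a ∈ ⋃ i, E i
      · rw [VectorMeasure.dirac_apply_of_mem (MeasurableSet.iUnion hE) ha, indicator_of_mem ha]
      · rw [VectorMeasure.dirac_apply_of_notMem ha, indicator_of_notMem ha]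

/-- The measure `f(x) dx`, for `f` integrable on all bounded Borel sets. -/
def ofFun (f : ℝ≥0 → ℂ) (hf : ∀ E, Bornology.IsBounded E → IntegrableOn f E leb) :
    LocComplexMeasure where
  toFun E := open Classical in
    if MeasurableSet E ∧ Bornology.IsBounded E then ∫ x in E, f x ∂leb else 0
  eq_zero' E hE := by simp [hE]
  hasSum_iUnion' E hE hd hb := by
    have hb' (i : ℕ) : Bornology.IsBounded (E i) := hb.subset (subset_iUnion E i)
    simp only [hE, hb', hb, MeasurableSet.iUnion hE, and_self, if_true]
    exact hasSum_integral_iUnion hE hd (hf _ hb)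

end LocComplexMeasure

/-! ### The space `M(ω)` -/

/-- The space `M(ω)` of locally finite complex Borel measures `μ` on `[0, ∞)` with
`∫ ω d|μ| < ∞`. -/
def Mw (ω : Weight) : Submodule ℂ LocComplexMeasure where
  carrier := {μ | LocComplexMeasure.weightedMass ω μ < ∞}
  zero_mem' := by
    simp [LocComplexMeasure.weightedMass, LocComplexMeasure.variation_zero]
  add_mem' hμ hν :=
    (LocComplexMeasure.weightedMass_add_le ω _ _).trans_lt (ENNReal.add_lt_top.2 ⟨hμ, hν⟩)
  smul_mem' c μ hμ := by
    simp only [mem_ofPred_eq] at hμ ⊢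
    rw [LocComplexMeasure.weightedMass_smul]
    exact ENNReal.mul_lt_top ENNReal.coe_lt_top hμ

/-- The norm `‖μ‖ = ∫ ω d|μ|` of `M(ω)`. -/
instance (ω : Weight) : Norm (Mw ω) :=
  ⟨fun μ => (LocComplexMeasure.weightedMass ω (μ : LocComplexMeasure)).toReal⟩

lemma Mw.core (ω : Weight) : NormedSpace.Core ℂ (Mw ω) where
  norm_nonneg _ := ENNReal.toReal_nonneg
  norm_smul c μ := by
    change (LocComplexMeasure.weightedMass ω (c • (μ : LocComplexMeasure))).toReal = _
    rw [LocComplexMeasure.weightedMass_smul, ENNReal.toReal_mul]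
    rfl
  norm_triangle μ ν := by
    refine (ENNReal.toReal_mono (ENNReal.add_lt_top.2 ⟨μ.2, ν.2⟩).ne
      (LocComplexMeasure.weightedMass_add_le ω (μ : LocComplexMeasure) ν)).trans_eq ?_
    exact ENNReal.toReal_add (LT.lt.ne μ.2) (LT.lt.ne ν.2)
  norm_eq_zero_iff μ := by
    constructor
    · intro h
      rcases (ENNReal.toReal_eq_zero_iff _).1 h with h | h
      · exact Subtype.ext (LocComplexMeasure.eq_zero_of_weightedMass ω _ h)
      · exact absurd h (LT.lt.ne μ.2)
    · rintro rfl
      change (LocComplexMeasure.weightedMass ω 0).toReal = 0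
      simp [LocComplexMeasure.weightedMass, LocComplexMeasure.variation_zero]

instance (ω : Weight) : NormedAddCommGroup (Mw ω) := NormedAddCommGroup.ofCore (Mw.core ω)

instance (ω : Weight) : NormedSpace ℂ (Mw ω) := NormedSpace.ofCore (Mw.core ω)

/-- The unit point mass `δ_a` as an element of `M(ω)`. -/
def Mw.dirac (ω : Weight) (a : ℝ≥0) : Mw ω :=
  ⟨LocComplexMeasure.dirac a, by
    have h : (LocComplexMeasure.dirac a).variation ≤ Measure.dirac a := by
      refine LocComplexMeasure.variation_le _ _ fun E hE hb => ?_
      by_cases ha : a ∈ E <;> simp [LocComplexMeasure.dirac, hE, hb, ha]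
    refine (lintegral_mono' h le_rfl).trans_lt ?_
    rw [lintegral_dirac]
    exact (ω.ennreal_ne_top a).lt_top⟩

lemma Weight.absolutelyContinuous (ω : Weight) : leb ≪ ω.measure :=
  withDensity_absolutelyContinuous' ω.measurable_ennreal.aemeasurable
    (Eventually.of_forall ω.ennreal_ne_zero)

lemma L1w.integrable_mul {ω : Weight} (f : L1w ω) : Integrable (fun x => (ω x : ℝ) • f x) leb := by
  have h := L1.integrable_coeFn f
  have h' := (integrable_withDensity_iff_integrable_smul₀ (μ := leb) (g := (f : ℝ≥0 → ℂ))
    ω.continuous.measurable.real_toNNReal.aemeasurable).1 h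
  refine h'.congr (Eventually.of_forall fun x => ?_)
  simp [NNReal.smul_def, (ω.pos x).le]

lemma L1w.integrableOn {ω : Weight} (f : L1w ω) (E : Set ℝ≥0) (hE : Bornology.IsBounded E) :
    IntegrableOn f E leb := by
  have hK : IsCompact (closure E) := Metric.isCompact_of_isClosed_isBounded isClosed_closure
    hE.closure
  have hc : ContinuousOn (fun x => (ω x)⁻¹) (closure E) :=
    (ω.continuous.inv₀ fun x => (ω.pos x).ne').continuousOn
  have h := IntegrableOn.continuousOn_smul (L1w.integrable_mul f).integrableOn hc hK
  refine IntegrableOn.mono_set (h.congr (Eventually.of_forall fun x => ?_)) subset_closure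
  simp [(ω.pos x).ne']

/-- The embedding of `L¹(ω)` into `M(ω)`: the function `f` is identified with the measure
`f(x) dx`. -/
def L1w.toMw (ω : Weight) : L1w ω →ₗ[ℂ] Mw ω where
  toFun f := ⟨LocComplexMeasure.ofFun f (L1w.integrableOn f), by
    have h : (LocComplexMeasure.ofFun f (L1w.integrableOn f)).variation
        ≤ leb.withDensity fun x => ‖f x‖ₑ := by
      refine LocComplexMeasure.variation_le _ _ fun E hE hb => ?_
      rw [withDensity_apply _ hE]
      simpa [LocComplexMeasure.ofFun, hE, hb] using enorm_integral_le_lintegral_enorm _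
    have hm : Measurable fun x => ‖f x‖ₑ := (Lp.stronglyMeasurable f).enorm
    refine (lintegral_mono' h le_rfl).trans_lt ?_
    have hf : ∫⁻ x, ‖f x‖ₑ ∂ω.measure < ∞ := (L1.integrable_coeFn f).hasFiniteIntegral
    have he := lintegral_withDensity_eq_lintegral_mul leb ω.measurable_ennreal hm
    replace hf := he.symm.trans_lt hf
    rw [lintegral_withDensity_eq_lintegral_mul _ hm ω.measurable_ennreal]
    simpa [mul_comm] using hf⟩
  map_add' f g := by
    refine Subtype.ext (LocComplexMeasure.ext (funext fun E => ?_))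
    change LocComplexMeasure.toFun _ E = LocComplexMeasure.toFun _ E + LocComplexMeasure.toFun _ E
    by_cases hE : MeasurableSet E ∧ Bornology.IsBounded E
    · simp only [LocComplexMeasure.ofFun, hE, and_self, if_true]
      rw [← integral_add (L1w.integrableOn f E hE.2) (L1w.integrableOn g E hE.2)]
      exact integral_congr_ae (ae_restrict_of_ae (ω.absolutelyContinuous.ae_le (Lp.coeFn_add f g)))
    · simp [LocComplexMeasure.ofFun, hE]
  map_smul' c f := by
    refine Subtype.ext (LocComplexMeasure.ext (funext fun E => ?_))
    change LocComplexMeasure.toFun _ E = c • LocComplexMeasure.toFun _ E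
    by_cases hE : MeasurableSet E ∧ Bornology.IsBounded E
    · simp only [LocComplexMeasure.ofFun, hE, and_self, if_true]
      rw [← integral_smul]
      exact integral_congr_ae (ae_restrict_of_ae (ω.absolutelyContinuous.ae_le (Lp.coeFn_smul c f)))
    · simp [LocComplexMeasure.ofFun, hE]

/-! ### The operators -/

/-- Condition (C): there is a constant `C` with `∫₀¹ ω₂(s/t) ψ(t)/t dt ≤ C ω₁(s)` for all `s ≥ 0`.
The integral of the non-negative integrand is taken in `[0, ∞]`. -/
def ConditionC (ψ : ℝ≥0 → ℝ) (ω₁ ω₂ : Weight) : Prop :=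
  ∃ C : ℝ, ∀ s : ℝ≥0,
    ∫⁻ t in Ioc (0 : ℝ≥0) 1, ENNReal.ofReal (ω₂ (s / t) * (ψ t / t)) ∂leb
      ≤ ENNReal.ofReal (C * ω₁ s)

/-- `U` is the operator `U_ψ : L¹(ω₁) → L¹(ω₂)`, that is, for every `f` in `L¹(ω₁)`, the integral
in `(U f)(x) = ∫₀¹ f(t x) ψ(t) dt` converges absolutely and the identity holds, for almost all
`x`. -/
def IsHardyCesaro (ψ : ℝ≥0 → ℝ) {ω₁ ω₂ : Weight} (U : L1w ω₁ →L[ℂ] L1w ω₂) : Prop :=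
  ∀ f : L1w ω₁, ∀ᵐ x ∂leb,
    IntegrableOn (fun t => f (t * x) * (ψ t : ℂ)) (Ioc 0 1) leb ∧
      U f x = ∫ t in Ioc (0 : ℝ≥0) 1, f (t * x) * (ψ t : ℂ) ∂leb

/-- `V` is the restriction to `C₀(1/ω₂)` of the adjoint `U* : L^∞(1/ω₂) → L^∞(1/ω₁)` of `U`,
considered as a map into `C₀(1/ω₁)`. Here the dual of `L¹(ω)` is `L^∞(1/ω)` through the pairing
`⟨f, h⟩ = ∫ f h dx`, so this says that `⟨U f, g⟩ = ⟨f, V g⟩`. -/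
def IsAdjointRestriction {ω₁ ω₂ : Weight} (U : L1w ω₁ →L[ℂ] L1w ω₂)
    (V : C0w ω₂ →L[ℂ] C0w ω₁) : Prop :=
  ∀ (g : C0w ω₂) (f : L1w ω₁), ∫ x, U f x * g x ∂leb = ∫ x, f x * V g x ∂leb

/-- `T` is the adjoint `V* : M(ω₁) → M(ω₂)` of `V`, the dual of `C₀(1/ω)` being `M(ω)` through the
pairing `⟨g, μ⟩ = ∫ g dμ`: this says that `⟨g, T μ⟩ = ⟨V g, μ⟩`. -/
def IsMeasureAdjoint {ω₁ ω₂ : Weight} (V : C0w ω₂ →L[ℂ] C0w ω₁)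
    (T : Mw ω₁ →L[ℂ] Mw ω₂) : Prop :=
  ∀ (μ : Mw ω₁) (g : C0w ω₂), (T μ : LocComplexMeasure).integral g =
    (μ : LocComplexMeasure).integral (V g)

/-- The function `(W_ψ μ)(x) = (1/x) ∫_{(0,x)} ψ(s/x) dμ(s)`. -/
def wFun (ψ : ℝ≥0 → ℝ) (μ : LocComplexMeasure) (x : ℝ≥0) : ℂ :=
  (1 / ((x : ℝ) : ℂ)) * ∫ᵛ s, (ψ (s / x) : ℂ) ∂[ContinuousLinearMap.mul ℝ ℂ;
    μ.restrict (Ioo 0 x) measurableSet_Ioo (Metric.isBounded_Ioo 0 x)]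

end

end HardyCesaro

open HardyCesaro

namespace HardyCesaro

/-! ### Lebesgue measure on the half-line -/

/-! Everything comes from one kernel, k(s, x) = ψ(s/x)/x on 0 < s < x (`wKernel`). Integrating it
over s against μ gives W_ψ μ (`Admissible.wFun_eq`). Integrating it over x against g gives, after
the substitution x = s/t, the function V_ψ g(s) = ∫₀¹ g(s/t) ψ(t)/t dt for s > 0
(`integral_wKernel`). The same substitution turns condition (C) into ∫ ω₂(x) k(s, x) dx ≤ C ω₁(s).
By Tonelli, W_ψ is then bounded from M(ω₁) to L¹(ω₂), and g(x) k(s, x) is integrable for dx × |μ|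
whenever g lies in C₀(1/ω₂). Fubini yields the duality `Admissible.integral_mul_wFun`, from which
the formulas are read off.

The substitution fails only at s = 0. There s/t = 0 for every t, so V_ψ g(0) = g(0) ∫₀¹ ψ(t)/t dt,
while the kernel vanishes. An atom of μ at 0 is therefore invisible to W_ψ and contributes exactly
the multiple of δ₀. A measure f(x) dx has no such atom, so on L¹(ω₁) only W_ψ remains, and s = tx
identifies it with U_ψ.

That V_ψ g lies in C₀(1/ω₁) is proved first for g of bounded support, by dominated convergence:
condition (C) at s = 0 makes ψ(t)/t integrable. The estimate ‖V_ψ g‖ ≤ C ‖g‖ and density give the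
general case (`Admissible.vFun_mem`).

Integrals against complex measures are reduced to Bochner integrals by the polar decomposition dμ =
h d|μ| (`LocComplexMeasure.exists_represents`). Uniqueness holds because U_ψ is prescribed almost
everywhere, L¹(ω) separates C₀(1/ω) (`C0w.ext_of_integral`), and C₀(1/ω) separates M(ω)
(`Mw.ext_of_integral`). Finally, ψ matters only on [0, 1], so it may be replaced by the bounded
continuous function ψ(min(t, 1)). -/

lemma measurableEmbedding_coe : MeasurableEmbedding ((↑) : ℝ≥0 → ℝ) :=
  MeasurableEmbedding.subtype_coe measurableSet_Ici

lemma map_coe_leb : leb.map ((↑) : ℝ≥0 → ℝ) = volume.restrict (Ioi 0) := by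
  rw [leb, measurableEmbedding_coe.map_comap, restrict_Ioi_eq_restrict_Ici, NNReal.range_coe]

lemma setLIntegral_leb {S : Set ℝ≥0} {S' : Set ℝ} (hS : MeasurableSet S')
    (h : ∀ x : ℝ≥0, x ∈ S ↔ (x : ℝ) ∈ S') (F : ℝ≥0 → ℝ≥0∞) :
    ∫⁻ x in S, F x ∂leb = ∫⁻ y in S' ∩ Ioi 0, F y.toNNReal := by
  have hS' : S = (↑) ⁻¹' S' := by ext x; exact h x
  rw [← Measure.restrict_restrict hS, ← map_coe_leb, hS',
    measurableEmbedding_coe.restrict_map, measurableEmbedding_coe.lintegral_map]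
  simp

lemma lintegral_leb (F : ℝ≥0 → ℝ≥0∞) : ∫⁻ x, F x ∂leb = ∫⁻ y in Ioi (0 : ℝ), F y.toNNReal := by
  rw [← setLIntegral_univ, setLIntegral_leb MeasurableSet.univ (by simp), univ_inter]

instance : IsFiniteMeasureOnCompacts leb where
  lt_top_of_isCompact K hK := by
    rw [leb, measurableEmbedding_coe.comap_apply]
    exact (hK.image NNReal.continuous_coe).measure_lt_top

instance : SigmaFinite leb := inferInstance

instance : Measure.IsOpenPosMeasure leb where
  open_pos U hU := by
    rintro ⟨a, ha⟩
    obtain ⟨b, hab, hb⟩ : ∃ b, a < b ∧ Ico a b ⊆ U :=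
      exists_Ico_subset_of_mem_nhds (hU.mem_nhds ha) ⟨a + 1, by simp⟩
    refine (lt_of_lt_of_le ?_ (measure_mono hb)).ne'
    have h : ((↑) : ℝ≥0 → ℝ) '' Ico a b = Ico (a : ℝ) b := by
      ext x
      constructor
      · rintro ⟨y, hy, rfl⟩
        exact hy
      · intro hx
        exact ⟨⟨x, a.2.trans hx.1⟩, hx, rfl⟩
    rw [leb, measurableEmbedding_coe.comap_apply, h, Real.volume_Ico]
    simpa using hab

instance : NullSingletonClass leb where
  measure_singleton x := by
    rw [leb, measurableEmbedding_coe.comap_apply]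
    simp

lemma lintegral_leb_comp_mul {x : ℝ≥0} (hx : 0 < x) (F : ℝ≥0 → ℝ≥0∞) :
    ∫⁻ t, F (t * x) * x ∂leb = ∫⁻ s, F s ∂leb := by
  have hx' : (0 : ℝ) < x := hx
  have him : (fun t : ℝ => t * x) '' Ioi 0 = Ioi 0 := by
    ext y
    constructor
    · rintro ⟨t, ht, rfl⟩
      exact mul_pos ht hx'
    · intro hy
      exact ⟨y / x, div_pos hy hx', by field_simp⟩
  have h := lintegral_image_eq_lintegral_abs_deriv_mul (f := fun t : ℝ => t * x)
    measurableSet_Ioi (fun t (_ : t ∈ Ioi (0 : ℝ)) =>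
      ((hasDerivAt_id t).mul_const (x : ℝ)).hasDerivWithinAt)
    (fun a _ b _ h => mul_right_cancel₀ hx'.ne' h) fun y => F y.toNNReal
  rw [lintegral_leb, lintegral_leb, ← him, h, him]
  refine setLIntegral_congr_fun measurableSet_Ioi fun t ht => ?_
  simp [Real.toNNReal_mul (le_of_lt ht), mul_comm]

/-- The substitution x = s/t maps (0, 1) bijectively onto (s, ∞) and carries dx/x to dt/t. -/
lemma lintegral_leb_comp_div {s : ℝ≥0} (hs : 0 < s) (F : ℝ≥0 → ℝ≥0∞) :
    ∫⁻ x in Ioi s, F x * (x⁻¹ : ℝ≥0) ∂leb = ∫⁻ t in Ioo 0 1, F (s / t) * (t⁻¹ : ℝ≥0) ∂leb := by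
  have hs' : (0 : ℝ) < s := hs
  have him : (fun t : ℝ => s / t) '' Ioo 0 1 = Ioi (s : ℝ) := by
    ext x
    constructor
    · rintro ⟨t, ht, rfl⟩
      exact (lt_div_iff₀ ht.1).2 (mul_lt_of_lt_one_right hs' ht.2)
    · intro hx
      have hx0 : 0 < x := hs'.trans hx
      exact ⟨s / x, ⟨by positivity, (div_lt_one hx0).2 hx⟩, by field_simp⟩
  rw [setLIntegral_leb (S' := Ioi (s : ℝ)) measurableSet_Ioi (by simp),
    setLIntegral_leb (S' := Ioo 0 1) measurableSet_Ioo (fun x => by simp [← NNReal.coe_lt_one]),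
    inter_eq_left.2 (Ioi_subset_Ioi hs'.le), inter_eq_left.2 Ioo_subset_Ioi_self, ← him,
    lintegral_image_eq_lintegral_abs_deriv_mul (f' := fun t => s * (-(t ^ 2)⁻¹)) measurableSet_Ioo
      (fun t ht => (((hasDerivAt_inv ht.1.ne').const_mul (s : ℝ)).congr_of_eventuallyEq
        (by simp [div_eq_mul_inv])).hasDerivWithinAt) ?_]
  · refine setLIntegral_congr_fun measurableSet_Ioo fun t ht => ?_
    have ht0 : 0 < t := ht.1
    have h1 : (s / t : ℝ).toNNReal = s / t.toNNReal := by
      rw [Real.toNNReal_div hs'.le, Real.toNNReal_coe]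
    -- The Jacobian s/t² times 1/x = t/s leaves 1/t.
    have h2 : ENNReal.ofReal |s * (-(t ^ 2)⁻¹)| * ((s / t.toNNReal)⁻¹ : ℝ≥0)
        = (t.toNNReal⁻¹ : ℝ≥0) := by
      rw [ENNReal.ofReal, ← ENNReal.coe_mul]
      congr 1
      apply NNReal.coe_injective
      have h3 : (0 : ℝ) ≤ s / t ^ 2 := by positivity
      simp only [mul_neg, abs_neg, Real.coe_toNNReal', NNReal.coe_inv,
        NNReal.coe_div, max_eq_left ht0.le, ← div_eq_mul_inv, abs_of_nonneg h3, max_eq_left h3]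
      field_simp
    simp only [h1]
    rw [mul_left_comm, h2]
  · intro a ha b hb h
    have := ha.1.ne'
    have := hb.1.ne'
    simp only at h
    field_simp at h
    exact h.symm

/-! ### Complex measures with a density -/

/-- The product g h is |h| g times the phase h/|h|, which is bounded by 1. Where h = 0 the phase is
0/0 = 0 and both sides vanish. -/
lemma integrable_mul_of_withDensity_enorm {X : Type*} [MeasurableSpace X] {m : Measure X}
    {h g : X → ℂ} (hh : Measurable h) (hg : Integrable g (m.withDensity fun x => ‖h x‖ₑ)) :
    Integrable (fun x => g x * h x) m := by
  have h1 := (integrable_withDensity_iff_integrable_smul hh.nnnorm).1 hg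
  have h2 := h1.bdd_mul (f := fun x => h x / (‖h x‖ : ℂ)) (c := 1)
    (hh.div (Complex.measurable_ofReal.comp hh.norm)).aestronglyMeasurable
    (Eventually.of_forall fun x => by
      rw [norm_div, Complex.norm_real, norm_norm]
      exact div_self_le_one _)
  refine h2.congr (Eventually.of_forall fun x => ?_)
  by_cases hx : h x = 0
  · simp [hx]
  · have : (‖h x‖ : ℂ) ≠ 0 := by simpa using hx
    simp only [NNReal.smul_def, coe_nnnorm, Complex.real_smul]
    field_simp

lemma lintegral_enorm_mul_eq {X : Type*} [MeasurableSpace X] {m : Measure X}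
    {h g : X → ℂ} (hh : Measurable h) (hg : Integrable g (m.withDensity fun x => ‖h x‖ₑ)) :
    ∫⁻ x, ‖g x * h x‖ₑ ∂m = ∫⁻ x, ‖g x‖ₑ ∂(m.withDensity fun x => ‖h x‖ₑ) := by
  rw [lintegral_withDensity_eq_lintegral_mul₀' hh.enorm.aemeasurable hg.1.enorm]
  simp [mul_comm]

/-- The variation of h dm is |h| dm, so the identity can be proved by induction on functions
integrable for |h| dm: indicators, sums, L¹ limits and modification on null sets. -/
lemma integral_withDensityᵥ_mul {X : Type*} [MeasurableSpace X] {m : Measure X} {h g : X → ℂ}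
    (hh : Measurable h) (hi : Integrable h m)
    (hg : Integrable g (m.withDensity fun x => ‖h x‖ₑ)) :
    ∫ᵛ x, g x ∂[ContinuousLinearMap.mul ℝ ℂ; m.withDensityᵥ h] = ∫ x, g x * h x ∂m := by
  have hv := Measure.variation_withDensityᵥ hi
  have hfin : IsFiniteMeasure (m.withDensityᵥ h).variation := by
    rw [hv]
    exact isFiniteMeasure_withDensity hi.2.ne
  have hmul {g : X → ℂ} (hg : Integrable g (m.withDensityᵥ h).variation) :
      Integrable (fun x => g x * h x) m :=
    integrable_mul_of_withDensity_enorm hh (hv ▸ hg)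
  have hlint {g : X → ℂ} (hg : Integrable g (m.withDensityᵥ h).variation) :
      ∫⁻ x, ‖g x * h x‖ₑ ∂m = ∫⁻ x, ‖g x‖ₑ ∂(m.withDensityᵥ h).variation := by
    rw [hv] at hg ⊢
    exact lintegral_enorm_mul_eq hh hg
  rw [← hv] at hg
  refine hg.induction (P := fun g => ∫ᵛ x, g x ∂[ContinuousLinearMap.mul ℝ ℂ; m.withDensityᵥ h]
    = ∫ x, g x * h x ∂m) ?_ ?_ ?_ ?_
  · intro c s hs _
    rw [VectorMeasure.integral_indicator_const c hs, withDensityᵥ_apply hi hs,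
      ContinuousLinearMap.mul_apply', ← integral_const_mul, ← integral_indicator hs]
    refine integral_congr_ae (Eventually.of_forall fun x => ?_)
    by_cases hx : x ∈ s <;> simp [hx]
  · intro f g _ hf hg hf' hg'
    rw [VectorMeasure.integral_add hf hg, hf', hg', ← integral_add (hmul hf) (hmul hg)]
    simp [add_mul]
  · refine isClosed_eq VectorMeasure.continuous_integral ?_
    refine continuous_iff_continuousAt.2 fun f => tendsto_integral_of_L1 _ ?_ ?_ ?_
    · exact (hmul (L1.integrable_coeFn f)).1
    · exact Eventually.of_forall fun g => hmul (L1.integrable_coeFn g)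
    -- Multiplication by h is an isometry from L¹(|h| dm) into L¹(m), so the right-hand side is
    -- continuous in g.
    · have h0 : Tendsto (fun g : X →₁[(m.withDensityᵥ h).variation] ℂ => edist g f) (𝓝 f) (𝓝 0) :=
        tendsto_iff_edist_tendsto_0.1 tendsto_id
      refine h0.congr fun g => ?_
      have := hlint ((L1.integrable_coeFn g).sub (L1.integrable_coeFn f))
      simp only [Pi.sub_apply, sub_mul] at this
      rw [this, Lp.edist_def, eLpNorm_one_eq_lintegral_enorm]
      rfl
  · intro f g hfg _ hf
    rw [← VectorMeasure.integral_congr_ae hfg, hf]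
    -- Equality almost everywhere for |h| dm says nothing where h = 0, but both integrands vanish
    -- there.
    have h1 : ∀ᵐ x ∂m, ‖h x‖ₑ ≠ 0 → f x = g x := by
      rw [hv] at hfg
      exact (ae_withDensity_iff hh.enorm).1 hfg
    refine integral_congr_ae ?_
    filter_upwards [h1] with x hx
    by_cases h0 : h x = 0
    · simp [h0]
    · rw [hx (by simpa using h0)]

/-! ### Locally finite complex measures with a density -/

namespace LocComplexMeasure

/-- `μ` is the measure `h dm`. -/
structure Represents (μ : LocComplexMeasure) (m : Measure ℝ≥0) (h : ℝ≥0 → ℂ) : Prop where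
  measurable : Measurable h
  integrableOn : ∀ E, Bornology.IsBounded E → IntegrableOn h E m
  apply_eq : ∀ E, MeasurableSet E → Bornology.IsBounded E → μ E = ∫ x in E, h x ∂m

lemma iUnion_Ico_nat : (⋃ n : ℕ, Ico (n : ℝ≥0) (n + 1)) = univ :=
  eq_univ_of_forall fun x => mem_iUnion.2 ⟨⌊x⌋₊, Nat.floor_le x.2, Nat.lt_floor_add_one x⟩

lemma floor_eq_of_mem_Ico {x : ℝ≥0} {n : ℕ} (hx : x ∈ Ico (n : ℝ≥0) (n + 1)) : ⌊x⌋₊ = n :=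
  (Nat.floor_eq_iff x.2).2 ⟨hx.1, hx.2⟩

lemma pairwise_disjoint_Ico_nat :
    Pairwise (Function.onFun Disjoint fun n : ℕ => Ico (n : ℝ≥0) (n + 1)) := by
  intro m n hmn
  exact disjoint_left.2 fun x hx hx' =>
    hmn ((floor_eq_of_mem_Ico hx).symm.trans (floor_eq_of_mem_Ico hx'))

lemma sum_restrict_Ico_nat (m : Measure ℝ≥0) :
    (Measure.sum fun n : ℕ => m.restrict (Ico (n : ℝ≥0) (n + 1))) = m := by
  rw [← Measure.restrict_iUnion pairwise_disjoint_Ico_nat (fun n => measurableSet_Ico),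
    iUnion_Ico_nat, Measure.restrict_univ]

namespace Represents

variable {μ : LocComplexMeasure} {m : Measure ℝ≥0} {h g : ℝ≥0 → ℂ}

lemma restrict_eq (hμ : μ.Represents m h) {K : Set ℝ≥0} (hK : MeasurableSet K)
    (hb : Bornology.IsBounded K) : μ.restrict K hK hb = (m.restrict K).withDensityᵥ h := by
  ext E hE
  rw [withDensityᵥ_apply (hμ.integrableOn K hb) hE, Measure.restrict_restrict hE,
    ← hμ.apply_eq _ (hE.inter hK) (hb.subset inter_subset_right)]
  simp [restrict, hE]

lemma isFiniteMeasure_restrict (hμ : μ.Represents m h) {K : Set ℝ≥0} (hb : Bornology.IsBounded K) :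
    IsFiniteMeasure ((m.restrict K).withDensity fun x => ‖h x‖ₑ) :=
  isFiniteMeasure_withDensity (hμ.integrableOn K hb).2.ne

lemma variation_restrict (hμ : μ.Represents m h) {K : Set ℝ≥0} (hK : MeasurableSet K)
    (hb : Bornology.IsBounded K) :
    (μ.restrict K hK hb).variation = (m.restrict K).withDensity fun x => ‖h x‖ₑ := by
  rw [hμ.restrict_eq, Measure.variation_withDensityᵥ (hμ.integrableOn K hb)]

lemma integral_restrict (hμ : μ.Represents m h) {K : Set ℝ≥0} (hK : MeasurableSet K)
    (hb : Bornology.IsBounded K)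
    (hg : Integrable g ((m.restrict K).withDensity fun x => ‖h x‖ₑ)) :
    ∫ᵛ x, g x ∂[ContinuousLinearMap.mul ℝ ℂ; μ.restrict K hK hb] = ∫ x in K, g x * h x ∂m := by
  rw [hμ.restrict_eq, integral_withDensityᵥ_mul hμ.measurable (hμ.integrableOn K hb) hg]

lemma variation_eq (hμ : μ.Represents m h) : μ.variation = m.withDensity fun x => ‖h x‖ₑ := by
  rw [variation, ← sum_restrict_Ico_nat (m.withDensity _)]
  congr 1 with n : 1
  rw [piece, hμ.variation_restrict, restrict_withDensity measurableSet_Ico]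

lemma lintegral_variation (hμ : μ.Represents m h) {F : ℝ≥0 → ℝ≥0∞} (hF : Measurable F) :
    ∫⁻ x, F x ∂μ.variation = ∫⁻ x, F x * ‖h x‖ₑ ∂m := by
  rw [hμ.variation_eq, lintegral_withDensity_eq_lintegral_mul _ hμ.measurable.enorm hF]
  simp [mul_comm]

lemma integrable_mul (hμ : μ.Represents m h) (hg : Integrable g μ.variation) :
    Integrable (fun x => g x * h x) m :=
  integrable_mul_of_withDensity_enorm hμ.measurable (hμ.variation_eq ▸ hg)

lemma integral_eq (hμ : μ.Represents m h) (hg : Integrable g μ.variation) :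
    μ.integral g = ∫ x, g x * h x ∂m := by
  have hi := hμ.integrable_mul hg
  have hs := hasSum_integral_iUnion (fun n : ℕ => measurableSet_Ico (a := (n : ℝ≥0)) (b := n + 1))
    pairwise_disjoint_Ico_nat hi.integrableOn
  rw [iUnion_Ico_nat, setIntegral_univ] at hs
  rw [integral, ← hs.tsum_eq]
  refine tsum_congr fun n => ?_
  rw [piece, hμ.integral_restrict]
  rw [← restrict_withDensity measurableSet_Ico, ← hμ.variation_eq]
  exact hg.integrableOn

lemma smul (hμ : μ.Represents m h) (c : ℂ) : (c • μ).Represents m fun x => c * h x where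
  measurable := hμ.measurable.const_mul c
  integrableOn E hE := (hμ.integrableOn E hE).const_mul c
  apply_eq E hE hb := by
    rw [MeasureTheory.integral_const_mul, ← hμ.apply_eq E hE hb]
    rfl

end Represents

lemma represents_dirac (a : ℝ≥0) : (dirac a).Represents (Measure.dirac a) fun _ => 1 where
  measurable := measurable_const
  integrableOn E _ := (integrable_const _).integrableOn
  apply_eq E hE hb := by
    by_cases ha : a ∈ E <;>
    simp [dirac, hE, hb, ha, Measure.real, Measure.dirac_apply' _ hE]

lemma represents_ofFun (f : ℝ≥0 → ℂ) (hf : ∀ E, Bornology.IsBounded E → IntegrableOn f E leb)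
    (hm : Measurable f) : (ofFun f hf).Represents leb f where
  measurable := hm
  integrableOn := hf
  apply_eq E hE hb := by simp [ofFun, hE, hb]

/-- A complex measure of finite variation has a density with respect to its variation. -/
lemma exists_density {X : Type*} [MeasurableSpace X] (c : ComplexMeasure X)
    [IsFiniteMeasure c.variation] :
    ∃ h : X → ℂ, Measurable h ∧ Integrable h c.variation ∧
      ∀ E, MeasurableSet E → c E = ∫ x in E, h x ∂c.variation := by
  -- Radon–Nikodym is applied separately to the real and imaginary parts, both dominated by the
  -- variation.
  have hac := c.absolutelyContinuous
  rw [VectorMeasure.ennrealVariation, ComplexMeasure.absolutelyContinuous_ennreal_iff] at hac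
  have hre := SignedMeasure.withDensityᵥ_rnDeriv_eq _ c.variation hac.1
  have him := SignedMeasure.withDensityᵥ_rnDeriv_eq _ c.variation hac.2
  set r := (ComplexMeasure.re c).rnDeriv c.variation
  set i := (ComplexMeasure.im c).rnDeriv c.variation
  have hr : Integrable r c.variation := SignedMeasure.integrable_rnDeriv _ _
  have hi : Integrable i c.variation := SignedMeasure.integrable_rnDeriv _ _
  have hint : Integrable (fun x => (r x : ℂ) + i x * Complex.I) c.variation :=
    hr.ofReal.add (hi.ofReal.mul_const _)
  refine ⟨fun x => (r x : ℂ) + i x * Complex.I, ?_, hint, fun E hE => ?_⟩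
  · have hr' : Measurable r := SignedMeasure.measurable_rnDeriv _ _
    have hi' : Measurable i := SignedMeasure.measurable_rnDeriv _ _
    fun_prop
  · rw [MeasureTheory.integral_add hr.ofReal.restrict (hi.ofReal.mul_const _).restrict,
      MeasureTheory.integral_mul_const]
    have h1 : ∫ x in E, (r x : ℂ) ∂c.variation = ((c E).re : ℂ) := by
      rw [integral_complex_ofReal, ← withDensityᵥ_apply hr hE, hre]
      rfl
    have h2 : ∫ x in E, (i x : ℂ) ∂c.variation = ((c E).im : ℂ) := by
      rw [integral_complex_ofReal, ← withDensityᵥ_apply hi hE, him]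
      rfl
    rw [h1, h2, Complex.re_add_im]

end LocComplexMeasure

/-! ### Polar decomposition and additivity of the integral -/

namespace LocComplexMeasure

/-- In the sum defining |μ|, only the n-th term charges [n, n + 1). -/
lemma variation_piece (μ : LocComplexMeasure) (n : ℕ) :
    (μ.piece n).variation = μ.variation.restrict (Ico (n : ℝ≥0) (n + 1)) := by
  have h0 (k : ℕ) (S : Set ℝ≥0) (hS : MeasurableSet S) (hd : Disjoint S (Ico (k : ℝ≥0) (k + 1))) :
      (μ.piece k).variation S = 0 := by
    rw [VectorMeasure.variation_apply_eq_zero hS]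
    intro t hts ht
    have : t ∩ Ico (k : ℝ≥0) (k + 1) = ∅ := (hd.mono_left hts).inter_eq
    simp [piece, restrict, ht, this, μ.empty]
  ext E hE
  rw [Measure.restrict_apply hE, variation, Measure.sum_apply _ (hE.inter measurableSet_Ico),
    tsum_eq_single n]
  · rw [← measure_inter_add_sdiff E measurableSet_Ico, h0 n (E \ _) (hE.diff measurableSet_Ico)
      disjoint_sdiff_left, add_zero]
  · intro k hk
    exact h0 k _ (hE.inter measurableSet_Ico)
      ((pairwise_disjoint_Ico_nat hk.symm).mono_left inter_subset_right)

lemma integrable_of_norm_le {ω : Weight} {μ : LocComplexMeasure} (hμ : weightedMass ω μ < ∞)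
    {g : ℝ≥0 → ℂ} (hg : Measurable g) {c : ℝ} (h : ∀ x, ‖g x‖ ≤ c * ω x) :
    Integrable g μ.variation := by
  have hω : Integrable (fun x => ω x) μ.variation := by
    refine ⟨ω.continuous.aestronglyMeasurable, ?_⟩
    refine lt_of_eq_of_lt (lintegral_congr fun x => ?_) hμ
    rw [Real.enorm_of_nonneg (ω.pos x).le, Weight.ennreal]
  exact (hω.const_mul c).mono' hg.aestronglyMeasurable (Eventually.of_forall h)

/-- On a compact set ω has a positive minimum, so finite weighted mass bounds |μ| there. -/
lemma isFiniteMeasureOnCompacts {ω : Weight} {μ : LocComplexMeasure}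
    (hμ : weightedMass ω μ < ∞) : IsFiniteMeasureOnCompacts μ.variation where
  lt_top_of_isCompact K hK := by
    rcases K.eq_empty_or_nonempty with rfl | hne
    · simp
    obtain ⟨x, -, hx⟩ := hK.exists_isMinOn hne ω.continuous.continuousOn
    have h1 : ω.ennreal x * μ.variation K ≤ weightedMass ω μ := by
      rw [weightedMass, ← setLIntegral_const]
      refine (setLIntegral_mono' hK.measurableSet fun y hy => ?_).trans (setLIntegral_le_lintegral _ _)
      exact ENNReal.ofReal_le_ofReal (hx hy)
    have h2 := h1.trans_lt hμ
    exact ENNReal.lt_top_of_mul_ne_top_right h2.ne (ω.ennreal_ne_zero x)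

lemma hasSum_piece (μ : LocComplexMeasure) {E : Set ℝ≥0} (hE : MeasurableSet E)
    (hb : Bornology.IsBounded E) : HasSum (fun n => μ.piece n E) (μ E) := by
  have h := μ.hasSum_iUnion' (fun n : ℕ => E ∩ Ico (n : ℝ≥0) (n + 1))
    (fun n => hE.inter measurableSet_Ico)
    (fun i j hij => (pairwise_disjoint_Ico_nat hij).mono inter_subset_right inter_subset_right)
    (hb.subset (by simp))
  rw [← inter_iUnion, iUnion_Ico_nat, inter_univ] at h
  simpa [piece, restrict, hE] using h

/-- The pieces of μ on the intervals [n, n + 1) have finite variation, hence densities; these are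
glued along the integer part of x. -/
lemma exists_represents {ω : Weight} {μ : LocComplexMeasure} (hμ : weightedMass ω μ < ∞) :
    ∃ h, μ.Represents μ.variation h := by
  have := isFiniteMeasureOnCompacts hμ
  have hb {E : Set ℝ≥0} (hE : Bornology.IsBounded E) : μ.variation E < ∞ :=
    (measure_mono subset_closure).trans_lt
      (Metric.isCompact_of_isClosed_isBounded isClosed_closure hE.closure).measure_lt_top
  have hfin (n : ℕ) : IsFiniteMeasure (μ.piece n).variation := by
    rw [variation_piece]
    exact ⟨by simpa using hb (Metric.isBounded_Ico _ _)⟩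
  choose h hm hi hE using fun n => exists_density (μ.piece n)
  let H : ℝ≥0 → ℂ := fun x => h ⌊x⌋₊ x
  have hH : Measurable H := by
    have : Measurable fun p : ℝ≥0 × ℕ => h p.2 p.1 := measurable_from_prod_countable_left hm
    exact this.comp (measurable_id.prodMk Nat.measurable_floor)
  have hHn (n : ℕ) {x : ℝ≥0} (hx : x ∈ Ico (n : ℝ≥0) (n + 1)) : H x = h n x := by
    simp only [H, floor_eq_of_mem_Ico hx]
  -- The variation of h d|c| is |h| d|c|; as it must equal |c|, the density has modulus 1 almost
  -- everywhere. This makes the glued density integrable on bounded sets.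
  have hnorm : ∀ n, ∀ᵐ x ∂(μ.piece n).variation, ‖h n x‖ₑ = 1 := by
    intro n
    have hc : μ.piece n = (μ.piece n).variation.withDensityᵥ (h n) := by
      ext E hE'
      rw [withDensityᵥ_apply (hi n) hE', hE n E hE']
    have hv := Measure.variation_withDensityᵥ (hi n)
    rw [← hc] at hv
    have := (withDensity_eq_iff (μ := (μ.piece n).variation) (f := fun x => ‖h n x‖ₑ) (g := 1)
      (hm n).enorm.aemeasurable aemeasurable_one (hi n).2.ne).1 (by rw [← hv, withDensity_one])
    exact this
  have hH1 : ∀ᵐ x ∂μ.variation, ‖H x‖ ≤ 1 := by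
    rw [← sum_restrict_Ico_nat μ.variation, Measure.ae_sum_iff]
    intro n
    rw [ae_restrict_iff' measurableSet_Ico, ← ae_restrict_iff' measurableSet_Ico]
    have := hnorm n
    rw [variation_piece] at this
    filter_upwards [this, ae_restrict_mem measurableSet_Ico] with x hx hxm
    rw [hHn n hxm, ← toReal_enorm, hx]
    simp
  have hint : ∀ E, Bornology.IsBounded E → IntegrableOn H E μ.variation := fun E hE =>
    Measure.integrableOn_of_bounded (M := 1) (hb hE).ne hH.aestronglyMeasurable
      (ae_restrict_of_ae hH1)
  refine ⟨H, hH, hint, fun E hEm hEb => ?_⟩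
  refine (μ.hasSum_piece hEm hEb).unique ?_
  have hs := hasSum_integral_iUnion (f := H) (μ := μ.variation)
    (s := fun n : ℕ => E ∩ Ico (n : ℝ≥0) (n + 1))
    (fun n => hEm.inter measurableSet_Ico)
    (fun i j hij => (pairwise_disjoint_Ico_nat hij).mono inter_subset_right inter_subset_right)
    (by rw [← inter_iUnion, iUnion_Ico_nat, inter_univ]; exact hint E hEb)
  rw [← inter_iUnion, iUnion_Ico_nat, inter_univ] at hs
  have hfun : (fun n => μ.piece n E) = fun n : ℕ => ∫ x in E ∩ Ico (n : ℝ≥0) (n + 1), H x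
      ∂μ.variation := funext fun n => ?_
  · rw [hfun]
    exact hs
  rw [hE n E hEm, variation_piece, Measure.restrict_restrict hEm]
  exact setIntegral_congr_fun (hEm.inter measurableSet_Ico) fun x hx => (hHn n hx.2).symm

/-- The integral is additive in the measure. -/
lemma integral_add {μ ν : LocComplexMeasure} {g : ℝ≥0 → ℂ} (hμ : Integrable g μ.variation)
    (hν : Integrable g ν.variation) : (μ + ν).integral g = μ.integral g + ν.integral g := by
  -- Adding the two series term by term needs their convergence, which follows from comparison with
  -- the integrals of |g| d|μ| over the same intervals.
  have hsum {μ : LocComplexMeasure} (hμ : Integrable g μ.variation) :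
      Summable fun n => ∫ᵛ x, g x ∂[ContinuousLinearMap.mul ℝ ℂ; μ.piece n] := by
    have hs := (hasSum_integral_iUnion
      (fun n : ℕ => measurableSet_Ico (a := (n : ℝ≥0)) (b := n + 1))
      pairwise_disjoint_Ico_nat hμ.norm.integrableOn).summable
    refine hs.of_norm_bounded fun n => ?_
    refine VectorMeasure.norm_integral_le_integral_norm.trans ?_
    rw [variation_piece]
    exact mul_le_of_le_one_left (integral_nonneg fun _ => norm_nonneg _)
      (ContinuousLinearMap.opNorm_mul_le ℝ ℂ)
  have hp {μ : LocComplexMeasure} (hμ : Integrable g μ.variation) (n : ℕ) :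
      (μ.piece n).Integrable g := by
    rw [VectorMeasure.Integrable, variation_piece]
    exact hμ.integrableOn
  rw [integral, integral, integral, ← (hsum hμ).tsum_add (hsum hν)]
  refine tsum_congr fun n => ?_
  rw [piece_add, VectorMeasure.integral_add_vectorMeasure (hp hμ n) (hp hν n)]

end LocComplexMeasure

/-! ### The space `C₀(1/ω)` -/

namespace C0w

variable {ω : Weight}

lemma norm_apply_le (g : C0w ω) (x : ℝ≥0) : ‖g x‖ ≤ ‖g‖ * ω x := by
  have h : ‖divWeight ω g x‖ ≤ ‖g‖ := (divWeight ω g).toBCF.norm_coe_le_norm x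
  have h' : ‖g x / (ω x : ℂ)‖ ≤ ‖g‖ := h
  rwa [norm_div, Complex.norm_real, Real.norm_of_nonneg (ω.pos x).le, div_le_iff₀ (ω.pos x)] at h'

lemma norm_le {g : C0w ω} {c : ℝ} (hc : 0 ≤ c) (h : ∀ x, ‖g x‖ ≤ c * ω x) : ‖g‖ ≤ c := by
  refine ((divWeight ω g).toBCF.norm_le hc).2 fun x => ?_
  change ‖g x / (ω x : ℂ)‖ ≤ c
  rw [norm_div, Complex.norm_real, Real.norm_of_nonneg (ω.pos x).le, div_le_iff₀ (ω.pos x)]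
  exact h x

lemma continuous (g : C0w ω) : Continuous g := g.2.1

/-- A continuous function vanishing outside a bounded interval, as an element of `C₀(1/ω)`. -/
def ofBounded (ω : Weight) (g : ℝ≥0 → ℂ) (hg : Continuous g) (R : ℝ≥0)
    (hR : ∀ x, R < x → g x = 0) : C0w ω :=
  ⟨g, hg, by
    refine tendsto_const_nhds.congr' ?_
    filter_upwards [(isCompact_Icc (a := (0 : ℝ≥0)) (b := R)).compl_mem_cocompact] with x hx
    rw [hR x (by simpa using hx), zero_div]⟩

lemma integrable (g : C0w ω) (μ : Mw ω) :
    Integrable g (μ : LocComplexMeasure).variation :=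
  LocComplexMeasure.integrable_of_norm_le μ.2 g.continuous.measurable g.norm_apply_le

end C0w

/-! ### Cutoffs, and measures determined by their integrals -/

/-- A continuous cutoff, equal to `1` on `[0, a]` and to `0` beyond `a + 1 / k`. -/
noncomputable def cutoff (a : ℝ≥0) (k : ℝ) (x : ℝ≥0) : ℝ := max 0 (1 - k * max 0 ((x : ℝ) - a))

lemma continuous_cutoff (a : ℝ≥0) (k : ℝ) : Continuous (cutoff a k) := by
  unfold cutoff
  fun_prop

lemma cutoff_nonneg (a : ℝ≥0) (k : ℝ) (x : ℝ≥0) : 0 ≤ cutoff a k x := le_max_left _ _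

lemma cutoff_le_one (a : ℝ≥0) {k : ℝ} (hk : 0 ≤ k) (x : ℝ≥0) : cutoff a k x ≤ 1 := by
  have : 0 ≤ k * max 0 ((x : ℝ) - a) := mul_nonneg hk (le_max_left _ _)
  exact max_le zero_le_one (by linarith)

lemma cutoff_eq_one {a : ℝ≥0} (k : ℝ) {x : ℝ≥0} (hx : x ≤ a) : cutoff a k x = 1 := by
  have : (x : ℝ) - a ≤ 0 := sub_nonpos.2 hx
  simp [cutoff, max_eq_left this]

lemma cutoff_eq_zero {a : ℝ≥0} {k : ℝ} {x : ℝ≥0} (hx : 1 ≤ k * (x - a)) (hk : 0 ≤ k) :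
    cutoff a k x = 0 := by
  have : k * (x - a) ≤ k * max 0 ((x : ℝ) - a) := mul_le_mul_of_nonneg_left (le_max_right _ _) hk
  exact max_eq_left (by linarith)

/-- The cutoff as an element of `C₀(1/ω)`. -/
noncomputable def C0w.cutoff (ω : Weight) (a : ℝ≥0) (k : ℕ) : C0w ω :=
  .ofBounded ω (fun x => (HardyCesaro.cutoff a (k + 1) x : ℂ))
    (Complex.continuous_ofReal.comp (continuous_cutoff _ _)) (a + 1) fun x hx => by
      rw [HardyCesaro.cutoff_eq_zero ?_ (by positivity), Complex.ofReal_zero]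
      have h1 : (a : ℝ) + 1 < x := by exact_mod_cast hx
      have h2 : (0 : ℝ) ≤ k := by positivity
      nlinarith

lemma tendsto_cutoff (a x : ℝ≥0) :
    Tendsto (fun k : ℕ => cutoff a (k + 1) x) atTop (𝓝 ((Iic a).indicator 1 x)) := by
  by_cases hx : x ≤ a
  · simp [cutoff_eq_one _ hx, hx]
  · rw [indicator_of_notMem (show x ∉ Iic a from hx)]
    refine tendsto_const_nhds.congr' ?_
    have h0 : (0 : ℝ) < x - a := sub_pos.2 (lt_of_not_ge hx)
    filter_upwards [eventually_ge_atTop ⌈1 / ((x : ℝ) - a)⌉₊] with k hk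
    refine (cutoff_eq_zero ?_ (by positivity)).symm
    rw [← div_le_iff₀ h0]
    exact (Nat.ceil_le.1 hk).trans (by simp)

/-- The cutoffs decrease to the indicator of [0, a], and the integrands are dominated by |h| on [0,
a + 1]. -/
lemma Mw.tendsto_integral_cutoff {ω : Weight} (μ : Mw ω) (a : ℝ≥0) :
    Tendsto (fun k => (μ : LocComplexMeasure).integral (C0w.cutoff ω a k)) atTop
      (𝓝 ((μ : LocComplexMeasure) (Iic a))) := by
  obtain ⟨h, hh⟩ := LocComplexMeasure.exists_represents μ.2
  have hb : Bornology.IsBounded (Iic a) := by rw [← Icc_bot]; exact Metric.isBounded_Icc _ _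
  have hb' : Bornology.IsBounded (Iic (a + 1)) := by
    rw [← Icc_bot]; exact Metric.isBounded_Icc _ _
  rw [hh.apply_eq _ measurableSet_Iic hb, ← integral_indicator measurableSet_Iic]
  simp_rw [fun k => hh.integral_eq ((C0w.cutoff ω a k).integrable μ)]
  refine tendsto_integral_of_dominated_convergence
    ((Iic (a + 1)).indicator fun x => ‖h x‖) (fun k => ?_) ?_ (fun k => ?_) ?_
  · exact ((C0w.cutoff ω a k).continuous.measurable.mul hh.measurable).aestronglyMeasurable
  · exact (integrable_indicator_iff measurableSet_Iic).2 (hh.integrableOn _ hb').norm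
  · refine Eventually.of_forall fun x => ?_
    by_cases hx : x ≤ a + 1
    · rw [indicator_of_mem (show x ∈ Iic (a + 1) from hx), norm_mul]
      refine mul_le_of_le_one_left (norm_nonneg _) ?_
      change ‖(cutoff a (k + 1) x : ℂ)‖ ≤ 1
      rw [Complex.norm_real, Real.norm_of_nonneg (cutoff_nonneg _ _ _)]
      exact cutoff_le_one _ (by positivity) _
    · rw [indicator_of_notMem (show x ∉ Iic (a + 1) from hx)]
      have : C0w.cutoff ω a k x = 0 := by
        change (cutoff a (k + 1) x : ℂ) = 0
        rw [cutoff_eq_zero ?_ (by positivity), Complex.ofReal_zero]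
        have h1 : (a : ℝ) + 1 < x := by exact_mod_cast lt_of_not_ge hx
        have h2 : (0 : ℝ) ≤ k := by positivity
        nlinarith
      simp [this]
  · refine Eventually.of_forall fun x => ?_
    have h1 := ((Complex.continuous_ofReal.tendsto _).comp (tendsto_cutoff a x)).mul_const (h x)
    have h2 : (Iic a).indicator (fun x => h x) x
        = (((Iic a).indicator (1 : ℝ≥0 → ℝ) x : ℝ) : ℂ) * h x := by
      by_cases hx : x ∈ Iic a
      · simp [indicator_of_mem hx]
      · simp [indicator_of_notMem hx]
    rw [← h2] at h1
    exact h1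

/-- The intervals [0, b] form a π-system generating the Borel sets. Restricting to [0, a] first
gives complex measures defined on all Borel sets, to which the π-λ argument applies. -/
lemma LocComplexMeasure.ext_of_Iic {μ ν : LocComplexMeasure} (h : ∀ a, μ (Iic a) = ν (Iic a)) :
    μ = ν := by
  have hb (a : ℝ≥0) : Bornology.IsBounded (Iic a) := by
    rw [← Icc_bot]; exact Metric.isBounded_Icc _ _
  have hr (a : ℝ≥0) : μ.restrict (Iic a) measurableSet_Iic (hb a)
      = ν.restrict (Iic a) measurableSet_Iic (hb a) := by
    refine VectorMeasure.ext_of_generateFrom (range Iic) ?_ (borel_eq_generateFrom_Iic ℝ≥0 ▸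
      BorelSpace.measurable_eq) ?_ ?_
    · rintro _ ⟨b, rfl⟩
      simp [restrict, Iic_inter_Iic, h]
    · exact isPiSystem_Iic
    · simp [restrict, h]
  refine LocComplexMeasure.ext (funext fun E => ?_)
  by_cases hE : MeasurableSet E ∧ Bornology.IsBounded E
  swap
  · rw [μ.eq_zero' E hE, ν.eq_zero' E hE]
  obtain ⟨a, ha⟩ := hE.2.bddAbove
  have := congrArg (fun c : ComplexMeasure ℝ≥0 => c E) (hr a)
  have hi : E ∩ Iic a = E := inter_eq_left.2 fun x hx => ha hx
  simpa [restrict, hE.1, hi] using this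

lemma Mw.ext_of_integral {ω : Weight} {μ ν : Mw ω} (h : ∀ g : C0w ω,
    (μ : LocComplexMeasure).integral g = (ν : LocComplexMeasure).integral g) : μ = ν := by
  refine Subtype.ext (LocComplexMeasure.ext_of_Iic fun a => ?_)
  refine tendsto_nhds_unique (Mw.tendsto_integral_cutoff μ a) ?_
  simpa only [h] using Mw.tendsto_integral_cutoff ν a

/-! ### The kernel of the Hardy–Cesàro operators -/

/-- The hypotheses on `ψ`, with `ψ` extended to a bounded continuous function on `[0, ∞)`, and
condition (C) with the constant `C`. -/
structure Admissible (ψ : ℝ≥0 → ℝ) (ω₁ ω₂ : Weight) (C : ℝ≥0) : Prop where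
  continuous : Continuous ψ
  nonneg : ∀ t, 0 ≤ ψ t
  bdd : ∃ M, ∀ t, ψ t ≤ M
  lintegral_le : ∀ s, ∫⁻ t in Ioc 0 1, ω₂.ennreal (s / t) * ENNReal.ofReal (ψ t / t) ∂leb
    ≤ C * ω₁.ennreal s

/-- The kernel `k(s, x) = ψ(s / x) / x` on `0 < s < x`. -/
noncomputable def wKernel (ψ : ℝ≥0 → ℝ) (s x : ℝ≥0) : ℝ :=
  if 0 < s ∧ s < x then ψ (s / x) / x else 0

/-- The function `(V_ψ g)(s) = ∫₀¹ g(s / t) ψ(t) / t dt`. -/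
noncomputable def vFun (ψ : ℝ≥0 → ℝ) (g : ℝ≥0 → ℂ) (s : ℝ≥0) : ℂ :=
  ∫ t in Ioc (0 : ℝ≥0) 1, g (s / t) * ((ψ t / t : ℝ) : ℂ) ∂leb

/-- The substitution x = s/t as an identity of measures, so that it also applies to complex
integrands. -/
lemma map_div_leb {s : ℝ≥0} (hs : 0 < s) :
    ((leb.restrict (Ioo 0 1)).withDensity fun t => ((t⁻¹ : ℝ≥0) : ℝ≥0∞)).map (fun t => s / t)
      = (leb.restrict (Ioi s)).withDensity fun x => ((x⁻¹ : ℝ≥0) : ℝ≥0∞) := by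
  have hm : Measurable fun t : ℝ≥0 => s / t := measurable_const.div measurable_id
  have hi : Measurable fun t : ℝ≥0 => ((t⁻¹ : ℝ≥0) : ℝ≥0∞) := measurable_inv.coe_nnreal_ennreal
  ext E hE
  rw [Measure.map_apply hm hE, withDensity_apply _ (hm hE), withDensity_apply _ hE,
    ← lintegral_indicator (hm hE), ← lintegral_indicator hE]
  have h := lintegral_leb_comp_div hs (E.indicator 1)
  convert h.symm using 2
  · ext t
    by_cases ht : s / t ∈ E <;> simp [ht]
  · ext x
    by_cases hx : x ∈ E <;> simp [hx]

section

variable {ψ : ℝ≥0 → ℝ}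

lemma measurable_wKernel (hψ : Continuous ψ) :
    Measurable fun p : ℝ≥0 × ℝ≥0 => wKernel ψ p.1 p.2 := by
  have h1 : Measurable fun p : ℝ≥0 × ℝ≥0 => ψ (p.1 / p.2) / p.2 :=
    (hψ.measurable.comp (measurable_fst.div measurable_snd)).div
      (measurable_snd.coe_nnreal_real)
  exact Measurable.ite ((measurableSet_lt measurable_const measurable_fst).inter
    (measurableSet_lt (f := fun p : ℝ≥0 × ℝ≥0 => p.1)
      (g := fun p => p.2) measurable_fst measurable_snd)) h1 measurable_const

lemma wKernel_nonneg (h0 : ∀ t, 0 ≤ ψ t) (s x : ℝ≥0) : 0 ≤ wKernel ψ s x := by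
  unfold wKernel
  split_ifs
  · exact div_nonneg (h0 _) x.2
  · exact le_rfl

lemma wKernel_zero (x : ℝ≥0) : wKernel ψ 0 x = 0 := by simp [wKernel]

lemma wKernel_eq_indicator {s : ℝ≥0} (hs : 0 < s) (x : ℝ≥0) :
    wKernel ψ s x = (Ioi s).indicator (fun x => ψ (s / x) / x) x := by
  by_cases hx : s < x
  · rw [indicator_of_mem (show x ∈ Ioi s from hx), wKernel, if_pos ⟨hs, hx⟩]
  · rw [indicator_of_notMem (show x ∉ Ioi s from hx), wKernel, if_neg (fun h => hx h.2)]

lemma restrict_Ioo_leb : leb.restrict (Ioo 0 1) = leb.restrict (Ioc 0 1) :=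
  Measure.restrict_congr_set Ioo_ae_eq_Ioc

/-- With F = ω₂ the right-hand side is the integral in condition (C). -/
lemma lintegral_wKernel {s : ℝ≥0} (hs : 0 < s) (F : ℝ≥0 → ℝ≥0∞) :
    ∫⁻ x, F x * ENNReal.ofReal (wKernel ψ s x) ∂leb
      = ∫⁻ t in Ioc 0 1, F (s / t) * ENNReal.ofReal (ψ t / t) ∂leb := by
  have hdiv (a : ℝ) (y : ℝ≥0) :
      ENNReal.ofReal (a / y) = ENNReal.ofReal a * ((y⁻¹ : ℝ≥0) : ℝ≥0∞) := by
    rw [div_eq_mul_inv, ENNReal.ofReal_mul' (by positivity), ← NNReal.coe_inv,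
      ENNReal.ofReal_coe_nnreal]
  have h := lintegral_leb_comp_div hs fun x => F x * ENNReal.ofReal (ψ (s / x))
  rw [restrict_Ioo_leb] at h
  calc ∫⁻ x, F x * ENNReal.ofReal (wKernel ψ s x) ∂leb
      = ∫⁻ x in Ioi s, F x * ENNReal.ofReal (ψ (s / x)) * ((x⁻¹ : ℝ≥0) : ℝ≥0∞) ∂leb := by
        rw [← lintegral_indicator measurableSet_Ioi]
        refine lintegral_congr fun x => ?_
        rw [wKernel_eq_indicator hs]
        by_cases hx : x ∈ Ioi s
        · simp only [indicator_of_mem hx, hdiv, mul_assoc]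
        · simp only [indicator_of_notMem hx, ENNReal.ofReal_zero, mul_zero]
    _ = _ := h
    _ = _ := by
        refine setLIntegral_congr_fun measurableSet_Ioc fun t ht => ?_
        simp only [div_div_cancel₀ hs.ne', hdiv, mul_assoc]

/-- This is what makes V_ψ the transpose of W_ψ. No integrability of g is needed, since the change
of variables holds for Bochner integrals unconditionally. -/
lemma integral_wKernel (hψ : Continuous ψ) {s : ℝ≥0} (hs : 0 < s) {g : ℝ≥0 → ℂ}
    (hg : Measurable g) :
    ∫ x, g x * (wKernel ψ s x : ℂ) ∂leb = vFun ψ g s := by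
  have hm : Measurable fun t : ℝ≥0 => s / t := measurable_const.div measurable_id
  have hinv : Measurable fun t : ℝ≥0 => t⁻¹ := measurable_inv
  have hG : Measurable fun x => g x * (ψ (s / x) : ℂ) :=
    hg.mul (Complex.measurable_ofReal.comp (hψ.measurable.comp hm))
  calc ∫ x, g x * (wKernel ψ s x : ℂ) ∂leb
      = ∫ x in Ioi s, x⁻¹ • (g x * (ψ (s / x) : ℂ)) ∂leb := by
        rw [← integral_indicator measurableSet_Ioi]
        refine integral_congr_ae (Eventually.of_forall fun x => ?_)
        simp only [wKernel_eq_indicator hs]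
        by_cases hx : x ∈ Ioi s
        · simp only [indicator_of_mem hx, NNReal.smul_def, Complex.real_smul]
          push_cast
          ring
        · simp only [indicator_of_notMem hx, Complex.ofReal_zero, mul_zero]
    _ = ∫ x, g x * (ψ (s / x) : ℂ)
          ∂(leb.restrict (Ioi s)).withDensity fun x => ((x⁻¹ : ℝ≥0) : ℝ≥0∞) :=
        (integral_withDensity_eq_integral_smul hinv _).symm
    _ = ∫ t, g (s / t) * (ψ (s / (s / t)) : ℂ)
          ∂(leb.restrict (Ioo 0 1)).withDensity fun x => ((x⁻¹ : ℝ≥0) : ℝ≥0∞) := by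
        rw [← map_div_leb hs, integral_map hm.aemeasurable hG.aestronglyMeasurable]
    _ = ∫ t in Ioc 0 1, t⁻¹ • (g (s / t) * (ψ (s / (s / t)) : ℂ)) ∂leb := by
        rw [integral_withDensity_eq_integral_smul hinv, restrict_Ioo_leb]
    _ = vFun ψ g s := by
        refine integral_congr_ae (Eventually.of_forall fun t => ?_)
        simp only [div_div_cancel₀ hs.ne', NNReal.smul_def, Complex.real_smul]
        push_cast
        ring

/-! ### The function `V_ψ g` -/

variable {ω₁ ω₂ : Weight} {C : ℝ≥0} {g : ℝ≥0 → ℂ} {c : ℝ}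

lemma measurable_vIntegrand (hψ : Continuous ψ) (hg : Measurable g) (s : ℝ≥0) :
    Measurable fun t : ℝ≥0 => g (s / t) * ((ψ t / t : ℝ) : ℂ) :=
  (hg.comp (measurable_const.div measurable_id)).mul
    (Complex.measurable_ofReal.comp (hψ.measurable.div measurable_coe_nnreal_real))

lemma Admissible.lintegral_vIntegrand_le (hψ : Admissible ψ ω₁ ω₂ C)
    (h : ∀ x, ‖g x‖ ≤ c * ω₂ x) (s : ℝ≥0) :
    ∫⁻ t in Ioc 0 1, ‖g (s / t) * ((ψ t / t : ℝ) : ℂ)‖ₑ ∂leb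
      ≤ ENNReal.ofReal c * (C * ω₁.ennreal s) := by
  refine le_trans ?_ (mul_le_mul_right (hψ.lintegral_le s) _)
  rw [← lintegral_const_mul' _ _ ENNReal.ofReal_ne_top]
  refine lintegral_mono fun t => ?_
  rw [enorm_mul, ← mul_assoc]
  refine mul_le_mul' ?_ ?_
  · rw [← ofReal_norm, Weight.ennreal, ← ENNReal.ofReal_mul' (ω₂.pos _).le]
    exact ENNReal.ofReal_le_ofReal (h _)
  · rw [← ofReal_norm, Complex.norm_real,
      Real.norm_of_nonneg (div_nonneg (hψ.nonneg _) t.coe_nonneg)]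

lemma Admissible.integrableOn_vIntegrand (hψ : Admissible ψ ω₁ ω₂ C) (hg : Measurable g)
    (h : ∀ x, ‖g x‖ ≤ c * ω₂ x) (s : ℝ≥0) :
    IntegrableOn (fun t : ℝ≥0 => g (s / t) * ((ψ t / t : ℝ) : ℂ)) (Ioc 0 1) leb :=
  ⟨(measurable_vIntegrand hψ.continuous hg s).aestronglyMeasurable,
    (hψ.lintegral_vIntegrand_le h s).trans_lt (ENNReal.mul_lt_top ENNReal.ofReal_lt_top
      (ENNReal.mul_lt_top ENNReal.coe_lt_top (ω₁.ennreal_ne_top s).lt_top))⟩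

lemma Admissible.norm_vFun_le (hψ : Admissible ψ ω₁ ω₂ C) (hc : 0 ≤ c)
    (h : ∀ x, ‖g x‖ ≤ c * ω₂ x) (s : ℝ≥0) : ‖vFun ψ g s‖ ≤ c * C * ω₁ s := by
  have h1 := (enorm_integral_le_lintegral_enorm _).trans (hψ.lintegral_vIntegrand_le h s)
  rw [← ofReal_norm, Weight.ennreal, ← ENNReal.ofReal_coe_nnreal, ← ENNReal.ofReal_mul C.coe_nonneg,
    ← ENNReal.ofReal_mul hc] at h1
  rw [mul_assoc]
  exact (ENNReal.ofReal_le_ofReal_iff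
    (mul_nonneg hc (mul_nonneg C.coe_nonneg (ω₁.pos s).le))).1 h1

lemma Admissible.vFun_add {g' : ℝ≥0 → ℂ} (hψ : Admissible ψ ω₁ ω₂ C) (hg : Measurable g)
    {c' : ℝ} (h : ∀ x, ‖g x‖ ≤ c * ω₂ x) (hg' : Measurable g') (h' : ∀ x, ‖g' x‖ ≤ c' * ω₂ x)
    (s : ℝ≥0) : vFun ψ (g + g') s = vFun ψ g s + vFun ψ g' s := by
  rw [vFun, vFun, vFun, ← integral_add (hψ.integrableOn_vIntegrand hg h s)
    (hψ.integrableOn_vIntegrand hg' h' s)]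
  simp [add_mul]

lemma vFun_smul (a : ℂ) (g : ℝ≥0 → ℂ) (s : ℝ≥0) : vFun ψ (a • g) s = a * vFun ψ g s := by
  rw [vFun, vFun, ← integral_const_mul]
  simp [mul_assoc]

/-- Condition (C) at s = 0 bounds ω₂(0) ∫₀¹ ψ(t)/t dt, because s/t = 0 for all t. -/
lemma Admissible.integrableOn_div (hψ : Admissible ψ ω₁ ω₂ C) :
    IntegrableOn (fun t : ℝ≥0 => ψ t / t) (Ioc 0 1) leb := by
  have h := (hψ.integrableOn_vIntegrand (g := fun x => (ω₂ x : ℂ)) (c := 1)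
    (Complex.measurable_ofReal.comp ω₂.continuous.measurable)
    (fun x => by simp [abs_of_pos (ω₂.pos x)]) 0).re.const_mul (ω₂ 0)⁻¹
  refine h.congr (Eventually.of_forall fun t => ?_)
  have := (ω₂.pos 0).ne'
  simp only [zero_div, ← Complex.ofReal_mul]
  change (ω₂ 0)⁻¹ * (ω₂ 0 * (ψ t / t)) = _
  field_simp

/-- The source of the coefficient of δ₀. -/
lemma vFun_zero (g : ℝ≥0 → ℂ) :
    vFun ψ g 0 = ((∫ t in Ioc (0 : ℝ≥0) 1, ψ t / (t : ℝ) ∂leb : ℝ) : ℂ) * g 0 := by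
  rw [vFun, ← integral_complex_ofReal, mul_comm, ← integral_const_mul]
  simp

/-- Dominated convergence with majorant B ψ(t)/t. Boundedness of g makes the majorant independent of
s. -/
lemma Admissible.continuous_vFun (hψ : Admissible ψ ω₁ ω₂ C) (hg : Continuous g) {B : ℝ}
    (hB : ∀ x, ‖g x‖ ≤ B) : Continuous (vFun ψ g) := by
  refine continuous_of_dominated (bound := fun t => B * (ψ t / t))
    (fun s => (measurable_vIntegrand hψ.continuous hg.measurable s).aestronglyMeasurable)
    (fun s => Eventually.of_forall fun t => ?_) (hψ.integrableOn_div.const_mul B) ?_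
  · rw [norm_mul, Complex.norm_real, Real.norm_of_nonneg (div_nonneg (hψ.nonneg _) t.coe_nonneg)]
    exact mul_le_mul_of_nonneg_right (hB _) (div_nonneg (hψ.nonneg _) t.coe_nonneg)
  · refine (ae_restrict_mem measurableSet_Ioc).mono fun t ht => ?_
    exact (hg.comp (continuous_id.div_const t)).mul continuous_const

/-- For t ≤ 1 one has s/t ≥ s > R. -/
lemma vFun_eq_zero {R : ℝ≥0} (hR : ∀ x, R < x → g x = 0) {s : ℝ≥0} (hs : R < s) :
    vFun ψ g s = 0 := by
  refine setIntegral_eq_zero_of_forall_eq_zero fun t ht => ?_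
  rw [hR, zero_mul]
  exact hs.trans_le (le_div_iff₀ ht.1 |>.2 (mul_le_of_le_one_right' ht.2))

/-- After division by ω the hypothesis is uniform approximation, which preserves both continuity and
vanishing at infinity. -/
lemma mem_c0Submodule_of_approx {ω : Weight} {F : ℝ≥0 → ℂ}
    (h : ∀ ε > 0, ∃ G ∈ c0Submodule ω, ∀ x, ‖F x - G x‖ ≤ ε * ω x) : F ∈ c0Submodule ω := by
  have hω (x : ℝ≥0) : (ω x : ℂ) ≠ 0 := by exact_mod_cast (ω.pos x).ne'
  have hωc : Continuous fun x => (ω x : ℂ) := Complex.continuous_ofReal.comp ω.continuous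
  have h' : ∀ ε > 0, ∃ G : ℝ≥0 → ℂ, Continuous G ∧ Tendsto G (cocompact ℝ≥0) (𝓝 0) ∧
      ∀ x, dist (F x / (ω x : ℂ)) (G x) < ε := by
    intro ε hε
    obtain ⟨G, hG, hFG⟩ := h (ε / 2) (half_pos hε)
    refine ⟨fun x => G x / (ω x : ℂ), hG.1.div hωc hω, hG.2, fun x => ?_⟩
    rw [dist_eq_norm, ← sub_div, norm_div, Complex.norm_real, Real.norm_of_nonneg (ω.pos x).le,
      div_lt_iff₀ (ω.pos x)]
    exact (hFG x).trans_lt (mul_lt_mul_of_pos_right (half_lt_self hε) (ω.pos x))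
  have hcont : Continuous fun x => F x / (ω x : ℂ) := by
    refine continuous_of_uniform_approx_of_continuous fun u hu => ?_
    obtain ⟨ε, hε, hu⟩ := Metric.mem_uniformity_dist.1 hu
    obtain ⟨G, hG, -, hFG⟩ := h' ε hε
    exact ⟨G, hG, fun x => hu (hFG x)⟩
  refine ⟨?_, ?_⟩
  · refine (hcont.mul hωc).congr fun x => ?_
    exact div_mul_cancel₀ _ (hω x)
  · refine Metric.tendsto_nhds.2 fun ε hε => ?_
    obtain ⟨G, -, hG, hFG⟩ := h' (ε / 2) (half_pos hε)
    filter_upwards [Metric.tendsto_nhds.1 hG (ε / 2) (half_pos hε)] with x hx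
    exact (dist_triangle _ (G x) _).trans_lt (by linarith [hFG x])

/-- Multiply g by a cutoff equal to 1 on an interval outside which |g| < ε ω. -/
lemma C0w.exists_approx {ω : Weight} (g : C0w ω) {ε : ℝ} (hε : 0 < ε) :
    ∃ (G : ℝ≥0 → ℂ) (R : ℝ≥0), Continuous G ∧ (∀ x, R < x → G x = 0) ∧
      ∀ x, ‖g x - G x‖ ≤ ε * ω x := by
  have hev := Metric.tendsto_nhds.1 g.2.2 ε hε
  obtain ⟨K, hK, hKε⟩ := mem_cocompact.1 hev
  obtain ⟨a, ha⟩ := hK.bddAbove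
  refine ⟨fun x => g x * (HardyCesaro.cutoff a 1 x : ℂ), a + 1, g.continuous.mul
    (Complex.continuous_ofReal.comp (continuous_cutoff _ _)), fun x hx => ?_, fun x => ?_⟩
  · have hx' : (a : ℝ) + 1 < x := by exact_mod_cast hx
    have h0 : HardyCesaro.cutoff a 1 x = 0 :=
      HardyCesaro.cutoff_eq_zero (by linarith) zero_le_one
    simp [h0]
  · by_cases hx : x ≤ a
    · have h1 : HardyCesaro.cutoff a 1 x = 1 := cutoff_eq_one _ hx
      simp only [h1, Complex.ofReal_one, mul_one, sub_self, norm_zero]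
      exact mul_nonneg hε.le (ω.pos x).le
    · have h1 : dist (g x / (ω x : ℂ)) 0 < ε := hKε fun hxK => hx (ha hxK)
      rw [dist_zero_right, norm_div, Complex.norm_real, Real.norm_of_nonneg (ω.pos x).le,
        div_lt_iff₀ (ω.pos x)] at h1
      have h2 : g x - g x * (HardyCesaro.cutoff a 1 x : ℂ)
          = g x * ((1 - HardyCesaro.cutoff a 1 x : ℝ) : ℂ) := by
        push_cast
        ring
      refine (congrArg norm h2).trans_le ?_
      rw [norm_mul, Complex.norm_real, Real.norm_of_nonneg
        (sub_nonneg.2 (cutoff_le_one a zero_le_one x))]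
      refine le_trans (mul_le_of_le_one_right (norm_nonneg _) ?_) h1.le
      linarith [cutoff_nonneg a 1 x]

lemma Admissible.vFun_mem (hψ : Admissible ψ ω₁ ω₂ C) (g : C0w ω₂) :
    vFun ψ g ∈ c0Submodule ω₁ := by
  refine mem_c0Submodule_of_approx fun ε hε => ?_
  -- Dividing ε by C + 1 instead of C covers the case C = 0.
  have hC : (0 : ℝ) < C + 1 := by positivity
  obtain ⟨G, R, hG, hR, hgG⟩ := g.exists_approx (div_pos hε hC)
  have hGω : ∀ x, ‖G x‖ ≤ (‖g‖ + ε / (C + 1)) * ω₂ x := fun x => by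
    have h1 := norm_sub_rev (g x) (G x) ▸ norm_sub_norm_le (G x) (g x)
    have h2 := g.norm_apply_le x
    have h3 := hgG x
    rw [add_mul]
    linarith
  obtain ⟨B, hB⟩ := (isCompact_Icc (a := 0) (b := R)).exists_bound_of_continuousOn hG.continuousOn
  have hGB : ∀ x, ‖G x‖ ≤ max B 0 := fun x => by
    by_cases hx : x ≤ R
    · exact (hB x ⟨zero_le, hx⟩).trans (le_max_left _ _)
    · simp [hR x (lt_of_not_ge hx)]
  refine ⟨vFun ψ G, (C0w.ofBounded ω₁ (vFun ψ G) (hψ.continuous_vFun hG hGB) R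
    fun x hx => vFun_eq_zero hR hx).2, fun s => ?_⟩
  have hsub : vFun ψ g s - vFun ψ G s = vFun ψ (fun x => g x - G x) s := by
    rw [sub_eq_iff_eq_add, ← hψ.vFun_add (g := fun x => g x - G x)
      (g.continuous.sub hG).measurable hgG hG.measurable hGω]
    congr 1
    ext x
    simp
  rw [hsub]
  refine (hψ.norm_vFun_le (div_pos hε hC).le hgG s).trans
    (mul_le_mul_of_nonneg_right ?_ (ω₁.pos s).le)
  rw [div_mul_eq_mul_div, div_le_iff₀ hC]
  nlinarith [C.coe_nonneg]

/-- The operator `V_ψ`. -/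
noncomputable def Admissible.vOp (hψ : Admissible ψ ω₁ ω₂ C) : C0w ω₂ →L[ℂ] C0w ω₁ :=
  LinearMap.mkContinuous
    { toFun := fun g => (⟨vFun ψ g, hψ.vFun_mem g⟩ : c0Submodule ω₁)
      map_add' := fun g g' => Subtype.ext (funext fun s =>
        hψ.vFun_add g.continuous.measurable g.norm_apply_le g'.continuous.measurable
          g'.norm_apply_le s)
      map_smul' := fun a g => Subtype.ext (funext fun s => vFun_smul a g s) } C fun g =>
    C0w.norm_le (by positivity) fun s => by
      rw [mul_comm (C : ℝ)]
      exact hψ.norm_vFun_le (norm_nonneg _) g.norm_apply_le s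

end

/-! ### The function `W_ψ μ` -/

section

variable {ψ : ℝ≥0 → ℝ} {ω₁ ω₂ : Weight} {C : ℝ≥0}

namespace Admissible

lemma integrable_comp_div (hψ : Admissible ψ ω₁ ω₂ C) (x : ℝ≥0) (m : Measure ℝ≥0)
    [IsFiniteMeasure m] : Integrable (fun s => (ψ (s / x) : ℂ)) m := by
  obtain ⟨M, hM⟩ := hψ.bdd
  refine Integrable.of_bound (C := M) (Complex.measurable_ofReal.comp
    (hψ.continuous.measurable.comp (measurable_id.div_const x))).aestronglyMeasurable
    (Eventually.of_forall fun s => ?_)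
  rw [Complex.norm_real, Real.norm_of_nonneg (hψ.nonneg _)]
  exact hM _

/-- The indicator of (0, x) and the factor 1/x are absorbed into the kernel, giving an ordinary
integral over the whole half-line. -/
lemma wFun_eq (hψ : Admissible ψ ω₁ ω₂ C) {μ : LocComplexMeasure} {m : Measure ℝ≥0}
    {h : ℝ≥0 → ℂ} (hμ : μ.Represents m h) (x : ℝ≥0) :
    wFun ψ μ x = ∫ s, (wKernel ψ s x : ℂ) * h s ∂m := by
  have hb : Bornology.IsBounded (Ioo 0 x) := Metric.isBounded_Ioo 0 x
  have := hμ.isFiniteMeasure_restrict hb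
  rw [wFun, hμ.integral_restrict _ _ (hψ.integrable_comp_div x _), ← integral_const_mul,
    ← integral_indicator measurableSet_Ioo]
  refine integral_congr_ae (Eventually.of_forall fun s => ?_)
  by_cases hs : s ∈ Ioo 0 x
  · rw [indicator_of_mem hs]
    simp only [wKernel, if_pos (show 0 < s ∧ s < x from hs)]
    push_cast
    ring
  · rw [indicator_of_notMem hs]
    simp only [wKernel, if_neg (show ¬ (0 < s ∧ s < x) from hs), Complex.ofReal_zero, zero_mul]

lemma wFun_add (hψ : Admissible ψ ω₁ ω₂ C) (μ ν : Mw ω₁) (x : ℝ≥0) :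
    wFun ψ ((μ + ν : Mw ω₁) : LocComplexMeasure) x = wFun ψ μ x + wFun ψ ν x := by
  have hi (μ : Mw ω₁) : ((μ : LocComplexMeasure).restrict (Ioo 0 x) measurableSet_Ioo
      (Metric.isBounded_Ioo 0 x)).Integrable fun s => (ψ (s / x) : ℂ) := by
    obtain ⟨h, hh⟩ := LocComplexMeasure.exists_represents μ.2
    have := hh.isFiniteMeasure_restrict (Metric.isBounded_Ioo 0 x)
    rw [VectorMeasure.Integrable, hh.variation_restrict]
    exact hψ.integrable_comp_div x _
  have hr : ((μ + ν : Mw ω₁) : LocComplexMeasure).restrict (Ioo 0 x) measurableSet_Ioo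
      (Metric.isBounded_Ioo 0 x) = (μ : LocComplexMeasure).restrict (Ioo 0 x) measurableSet_Ioo
      (Metric.isBounded_Ioo 0 x) + (ν : LocComplexMeasure).restrict (Ioo 0 x) measurableSet_Ioo
      (Metric.isBounded_Ioo 0 x) := by
    ext E hE
    simp [LocComplexMeasure.restrict, hE]
    rfl
  rw [wFun, hr, VectorMeasure.integral_add_vectorMeasure (hi μ) (hi ν), mul_add]
  rfl

lemma wFun_smul (hψ : Admissible ψ ω₁ ω₂ C) (a : ℂ) (μ : Mw ω₁) (x : ℝ≥0) :
    wFun ψ ((a • μ : Mw ω₁) : LocComplexMeasure) x = a * wFun ψ μ x := by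
  obtain ⟨h, hh⟩ := LocComplexMeasure.exists_represents μ.2
  rw [hψ.wFun_eq hh, ← integral_const_mul]
  change wFun ψ (a • (μ : LocComplexMeasure)) x = _
  rw [hψ.wFun_eq (hh.smul a)]
  simp only [mul_left_comm]

lemma lintegral_wKernel_le (hψ : Admissible ψ ω₁ ω₂ C) (s : ℝ≥0) :
    ∫⁻ x, ω₂.ennreal x * ENNReal.ofReal (wKernel ψ s x) ∂leb ≤ C * ω₁.ennreal s := by
  rcases eq_or_ne s 0 with rfl | hs
  · simp [wKernel_zero]
  · rw [lintegral_wKernel (pos_iff_ne_zero.2 hs)]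
    exact hψ.lintegral_le s

/-- Tonelli and condition (C). This single estimate gives both the boundedness of W_ψ and the
integrability required for Fubini. -/
lemma lintegral_prod_le (hψ : Admissible ψ ω₁ ω₂ C) {μ : LocComplexMeasure} {m : Measure ℝ≥0}
    [SFinite m] {h : ℝ≥0 → ℂ} (hμ : μ.Represents m h) :
    ∫⁻ x, ∫⁻ s, ω₂.ennreal x * ‖(wKernel ψ s x : ℂ) * h s‖ₑ ∂m ∂leb
      ≤ C * LocComplexMeasure.weightedMass ω₁ μ := by
  have hk := measurable_wKernel hψ.continuous
  rw [lintegral_lintegral_swap]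
  · rw [LocComplexMeasure.weightedMass, hμ.lintegral_variation ω₁.measurable_ennreal,
      ← lintegral_const_mul' _ _ ENNReal.coe_ne_top]
    refine lintegral_mono fun s => ?_
    rw [← mul_assoc]
    refine le_trans (le_of_eq ?_) (mul_le_mul_left (hψ.lintegral_wKernel_le s) _)
    rw [← lintegral_mul_const' _ _ enorm_ne_top]
    refine lintegral_congr fun x => ?_
    rw [enorm_mul, ← mul_assoc, ← ofReal_norm (wKernel ψ s x : ℂ), Complex.norm_real,
      Real.norm_of_nonneg (wKernel_nonneg hψ.nonneg s x)]
  · refine Measurable.aemeasurable ?_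
    refine (ω₂.measurable_ennreal.comp measurable_fst).mul (Measurable.enorm ?_)
    exact (Complex.measurable_ofReal.comp (hk.comp measurable_swap)).mul
      (hμ.measurable.comp measurable_snd)

lemma stronglyMeasurable_wFun (hψ : Admissible ψ ω₁ ω₂ C) (μ : Mw ω₁) :
    StronglyMeasurable (wFun ψ μ) := by
  obtain ⟨h, hh⟩ := LocComplexMeasure.exists_represents μ.2
  have := LocComplexMeasure.isFiniteMeasureOnCompacts μ.2
  have hk := measurable_wKernel hψ.continuous
  have : wFun ψ μ = fun x => ∫ s, (wKernel ψ s x : ℂ) * h s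
      ∂(μ : LocComplexMeasure).variation := funext fun x => hψ.wFun_eq hh x
  rw [this]
  refine StronglyMeasurable.integral_prod_right
    (f := fun x s => (wKernel ψ s x : ℂ) * h s) (Measurable.stronglyMeasurable ?_)
  exact (Complex.measurable_ofReal.comp (hk.comp measurable_swap)).mul
      (hh.measurable.comp measurable_snd)

lemma lintegral_wFun_le (hψ : Admissible ψ ω₁ ω₂ C) (μ : Mw ω₁) :
    ∫⁻ x, ‖wFun ψ μ x‖ₑ ∂ω₂.measure
      ≤ C * LocComplexMeasure.weightedMass ω₁ (μ : LocComplexMeasure) := by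
  obtain ⟨h, hh⟩ := LocComplexMeasure.exists_represents μ.2
  have := LocComplexMeasure.isFiniteMeasureOnCompacts μ.2
  rw [Weight.measure, lintegral_withDensity_eq_lintegral_mul _ ω₂.measurable_ennreal
    (hψ.stronglyMeasurable_wFun μ).enorm]
  refine le_trans (lintegral_mono fun x => ?_) (hψ.lintegral_prod_le hh)
  rw [Pi.mul_apply, lintegral_const_mul' _ _ (ω₂.ennreal_ne_top x), hψ.wFun_eq hh]
  exact mul_le_mul_right (enorm_integral_le_lintegral_enorm _) _

lemma memLp_wFun (hψ : Admissible ψ ω₁ ω₂ C) (μ : Mw ω₁) :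
    MemLp (wFun ψ μ) 1 ω₂.measure := by
  refine ⟨(hψ.stronglyMeasurable_wFun μ).aestronglyMeasurable, ?_⟩
  rw [eLpNorm_one_eq_lintegral_enorm]
  exact (hψ.lintegral_wFun_le μ).trans_lt (ENNReal.mul_lt_top ENNReal.coe_lt_top μ.2)

/-- The operator `W_ψ : M(ω₁) → L¹(ω₂)`. -/
noncomputable def wOp (hψ : Admissible ψ ω₁ ω₂ C) : Mw ω₁ →L[ℂ] L1w ω₂ :=
  LinearMap.mkContinuous
    { toFun := fun μ => (hψ.memLp_wFun μ).toLp (wFun ψ μ)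
      map_add' := fun μ ν => by
        rw [← MemLp.toLp_add]
        exact MemLp.toLp_congr _ _ (Eventually.of_forall fun x => hψ.wFun_add μ ν x)
      map_smul' := fun a μ => by
        rw [RingHom.id_apply, ← MemLp.toLp_const_smul]
        exact MemLp.toLp_congr _ _ (Eventually.of_forall fun x => hψ.wFun_smul a μ x) } C
    fun μ => by
      change ‖(hψ.memLp_wFun μ).toLp (wFun ψ μ)‖ ≤ C *
        (LocComplexMeasure.weightedMass ω₁ (μ : LocComplexMeasure)).toReal
      rw [Lp.norm_toLp, eLpNorm_one_eq_lintegral_enorm, ← ENNReal.coe_toReal, ← ENNReal.toReal_mul]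
      exact ENNReal.toReal_mono (ENNReal.mul_lt_top ENNReal.coe_lt_top μ.2).ne
        (hψ.lintegral_wFun_le μ)

lemma wOp_ae_eq (hψ : Admissible ψ ω₁ ω₂ C) (μ : Mw ω₁) : hψ.wOp μ =ᵐ[leb] wFun ψ μ :=
  ω₂.absolutelyContinuous.ae_le (hψ.memLp_wFun μ).coeFn_toLp

/-- The duality between `W_ψ` and `V_ψ`. -/
lemma integral_mul_wFun (hψ : Admissible ψ ω₁ ω₂ C) (μ : Mw ω₁) (g : C0w ω₂) :
    ∫ x, g x * wFun ψ μ x ∂leb + vFun ψ g 0 * (μ : LocComplexMeasure) {0}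
      = (μ : LocComplexMeasure).integral (hψ.vOp g) := by
  obtain ⟨h, hh⟩ := LocComplexMeasure.exists_represents μ.2
  have := LocComplexMeasure.isFiniteMeasureOnCompacts μ.2
  set m := (μ : LocComplexMeasure).variation
  have hk := measurable_wKernel hψ.continuous
  have hmeas : Measurable fun p : ℝ≥0 × ℝ≥0 => g p.1 * ((wKernel ψ p.2 p.1 : ℂ) * h p.2) :=
    (g.continuous.measurable.comp measurable_fst).mul
      ((Complex.measurable_ofReal.comp (hk.comp measurable_swap)).mul
        (hh.measurable.comp measurable_snd))
  have hint : Integrable (fun p : ℝ≥0 × ℝ≥0 => g p.1 * ((wKernel ψ p.2 p.1 : ℂ) * h p.2))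
      (leb.prod m) := by
    refine ⟨hmeas.aestronglyMeasurable, ?_⟩
    rw [HasFiniteIntegral, lintegral_prod _ hmeas.enorm.aemeasurable]
    calc _ ≤ ∫⁻ x, ∫⁻ s, ENNReal.ofReal ‖g‖ *
          (ω₂.ennreal x * ‖(wKernel ψ s x : ℂ) * h s‖ₑ) ∂m ∂leb := by
          refine lintegral_mono fun x => lintegral_mono fun s => ?_
          rw [enorm_mul, ← mul_assoc]
          refine mul_le_mul_left ?_ _
          rw [← ofReal_norm, Weight.ennreal, ← ENNReal.ofReal_mul' (ω₂.pos _).le]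
          exact ENNReal.ofReal_le_ofReal (g.norm_apply_le x)
      _ = ENNReal.ofReal ‖g‖ *
          ∫⁻ x, ∫⁻ s, ω₂.ennreal x * ‖(wKernel ψ s x : ℂ) * h s‖ₑ ∂m ∂leb := by
          rw [← lintegral_const_mul' _ _ ENNReal.ofReal_ne_top]
          simp_rw [lintegral_const_mul' _ _ ENNReal.ofReal_ne_top]
      _ < ∞ := ENNReal.mul_lt_top ENNReal.ofReal_lt_top
          ((hψ.lintegral_prod_le hh).trans_lt (ENNReal.mul_lt_top ENNReal.coe_lt_top μ.2))
  have hV := (hψ.vOp g).integrable μ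
  have hVh := hh.integrable_mul hV
  -- The point 0 is split off because the kernel represents V_ψ g only for s > 0.
  rw [hh.integral_eq hV, ← integral_add_compl (measurableSet_singleton (0 : ℝ≥0)) hVh, add_comm]
  congr 1
  · have h0 : ∀ s ∈ ({0} : Set ℝ≥0), hψ.vOp g s * h s = vFun ψ g 0 * h s := by
      rintro s rfl
      rfl
    rw [setIntegral_congr_fun (measurableSet_singleton 0) h0, integral_const_mul,
      hh.apply_eq _ (measurableSet_singleton 0) Bornology.isBounded_singleton]
  · calc ∫ x, g x * wFun ψ μ x ∂leb
        = ∫ x, ∫ s, g x * ((wKernel ψ s x : ℂ) * h s) ∂m ∂leb := by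
          simp_rw [integral_const_mul, ← hψ.wFun_eq hh]
      _ = ∫ s, ∫ x, g x * ((wKernel ψ s x : ℂ) * h s) ∂leb ∂m := integral_integral_swap hint
      _ = ∫ s in {0}ᶜ, hψ.vOp g s * h s ∂m := by
          rw [← integral_indicator (measurableSet_singleton 0).compl]
          refine integral_congr_ae (Eventually.of_forall fun s => ?_)
          by_cases hs : s = 0
          · simp [hs, wKernel_zero]
          · rw [indicator_of_mem (show s ∈ ({0}ᶜ : Set ℝ≥0) from hs)]
            simp_rw [← mul_assoc]
            rw [integral_mul_const, integral_wKernel hψ.continuous (pos_iff_ne_zero.2 hs)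
              g.continuous.measurable]
            rfl

end Admissible

/-! ### The operators `U_ψ` and its extension to measures -/

lemma L1w.represents {ω : Weight} (f : L1w ω) :
    (L1w.toMw ω f : LocComplexMeasure).Represents leb f :=
  LocComplexMeasure.represents_ofFun _ (L1w.integrableOn f) (Lp.stronglyMeasurable f).measurable

/-- The variation of f dx is |f| dx, so the embedding is isometric. -/
lemma L1w.norm_toMw {ω : Weight} (f : L1w ω) : ‖L1w.toMw ω f‖ = ‖f‖ := by
  have hm : Measurable fun x => ‖f x‖ₑ := (Lp.stronglyMeasurable f).enorm
  change (LocComplexMeasure.weightedMass ω (L1w.toMw ω f : LocComplexMeasure)).toReal = _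
  rw [Lp.norm_def, eLpNorm_one_eq_lintegral_enorm, LocComplexMeasure.weightedMass,
    (L1w.represents f).lintegral_variation ω.measurable_ennreal]
  congr 1
  exact (lintegral_withDensity_eq_lintegral_mul leb ω.measurable_ennreal hm).symm

/-- The embedding of `L¹(ω)` into `M(ω)` as a bounded operator. -/
noncomputable def L1w.toMwL (ω : Weight) : L1w ω →L[ℂ] Mw ω :=
  (L1w.toMw ω).mkContinuous 1 fun f => by rw [L1w.norm_toMw, one_mul]

lemma L1w.integral_toMw {ω : Weight} (f : L1w ω) (g : C0w ω) :
    (L1w.toMw ω f : LocComplexMeasure).integral g = ∫ x, g x * f x ∂leb :=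
  (L1w.represents f).integral_eq (g.integrable _)

lemma L1w.toMw_apply_singleton {ω : Weight} (f : L1w ω) (a : ℝ≥0) :
    (L1w.toMw ω f : LocComplexMeasure) {a} = 0 := by
  rw [(L1w.represents f).apply_eq _ (measurableSet_singleton a) Bornology.isBounded_singleton]
  exact setIntegral_measure_zero _ (measure_singleton a)

lemma L1w.ext_leb {ω : Weight} {f f' : L1w ω} (h : f =ᵐ[leb] f') : f = f' :=
  Lp.ext ((withDensity_absolutelyContinuous _ _).ae_le h)

lemma LocComplexMeasure.enorm_apply_singleton_le (μ : LocComplexMeasure) {ω : Weight}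
    (hμ : weightedMass ω μ < ∞) (a : ℝ≥0) :
    ω.ennreal a * ‖μ {a}‖ₑ ≤ weightedMass ω μ := by
  obtain ⟨h, hh⟩ := exists_represents hμ
  rw [hh.apply_eq _ (measurableSet_singleton a) Bornology.isBounded_singleton, weightedMass,
    hh.lintegral_variation ω.measurable_ennreal]
  refine le_trans ?_ (setLIntegral_le_lintegral {a} _)
  refine (mul_le_mul_right (enorm_integral_le_lintegral_enorm _) _).trans_eq ?_
  rw [← lintegral_const_mul' _ _ (ω.ennreal_ne_top a)]
  refine setLIntegral_congr_fun (measurableSet_singleton a) ?_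
  rintro s rfl
  rfl

/-- The bounded functional `μ ↦ μ {a}` on `M(ω)`. -/
noncomputable def Mw.evalSingleton (ω : Weight) (a : ℝ≥0) : Mw ω →L[ℂ] ℂ :=
  LinearMap.mkContinuous
    { toFun := fun μ => (μ : LocComplexMeasure) {a}
      map_add' := fun _ _ => rfl
      map_smul' := fun _ _ => rfl } (ω a)⁻¹ fun μ => by
    have h := ENNReal.toReal_mono (LT.lt.ne μ.2)
      ((μ : LocComplexMeasure).enorm_apply_singleton_le μ.2 a)
    rw [ENNReal.toReal_mul, toReal_enorm, Weight.ennreal, ENNReal.toReal_ofReal (ω.pos a).le] at h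
    rw [inv_mul_eq_div, le_div_iff₀' (ω.pos a)]
    exact h

lemma Mw.evalSingleton_apply {ω : Weight} (a : ℝ≥0) (μ : Mw ω) :
    Mw.evalSingleton ω a μ = (μ : LocComplexMeasure) {a} := rfl

lemma Mw.integral_smul_dirac {ω : Weight} (c : ℂ) (a : ℝ≥0) (g : C0w ω) :
    ((c • Mw.dirac ω a : Mw ω) : LocComplexMeasure).integral g = g a * c := by
  have h : ((c • Mw.dirac ω a : Mw ω) : LocComplexMeasure).Represents (Measure.dirac a)
      fun _ => c * 1 := (LocComplexMeasure.represents_dirac a).smul c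
  rw [h.integral_eq (g.integrable _), integral_dirac, mul_one]

namespace Admissible

/-- The operator `U_ψ`. -/
noncomputable def uOp (hψ : Admissible ψ ω₁ ω₂ C) : L1w ω₁ →L[ℂ] L1w ω₂ :=
  hψ.wOp.comp (L1w.toMwL ω₁)

/-- The extension of `U_ψ` to measures. -/
noncomputable def uBar (hψ : Admissible ψ ω₁ ω₂ C) : Mw ω₁ →L[ℂ] Mw ω₂ :=
  (L1w.toMwL ω₂).comp hψ.wOp +
    (((∫ t in Ioc (0 : ℝ≥0) 1, ψ t / (t : ℝ) ∂leb : ℝ) : ℂ) • Mw.evalSingleton ω₁ 0).smulRight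
      (Mw.dirac ω₂ 0)

lemma uBar_apply (hψ : Admissible ψ ω₁ ω₂ C) (μ : Mw ω₁) :
    hψ.uBar μ = L1w.toMw ω₂ (hψ.wOp μ) +
      (((∫ t in Ioc (0 : ℝ≥0) 1, ψ t / (t : ℝ) ∂leb : ℝ) : ℂ) *
        (μ : LocComplexMeasure) {0}) • Mw.dirac ω₂ 0 := rfl

lemma isMeasureAdjoint (hψ : Admissible ψ ω₁ ω₂ C) : IsMeasureAdjoint hψ.vOp hψ.uBar := by
  intro μ g
  rw [← hψ.integral_mul_wFun, hψ.uBar_apply]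
  refine (LocComplexMeasure.integral_add (g.integrable _) (g.integrable _)).trans ?_
  rw [L1w.integral_toMw, Mw.integral_smul_dirac, vFun_zero]
  congr 1
  · refine integral_congr_ae ?_
    filter_upwards [hψ.wOp_ae_eq μ] with x hx
    rw [hx]
  · ring

lemma isMeasureAdjoint_iff (hψ : Admissible ψ ω₁ ω₂ C) (T : Mw ω₁ →L[ℂ] Mw ω₂) :
    IsMeasureAdjoint hψ.vOp T ↔ T = hψ.uBar := by
  refine ⟨fun h => ContinuousLinearMap.ext fun μ => Mw.ext_of_integral fun g => ?_, ?_⟩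
  · rw [h μ g, hψ.isMeasureAdjoint μ g]
  · rintro rfl
    exact hψ.isMeasureAdjoint

/-- The measure f dx has no atom at 0, so the extra term in the duality drops out. -/
lemma isAdjointRestriction (hψ : Admissible ψ ω₁ ω₂ C) :
    IsAdjointRestriction hψ.uOp hψ.vOp := by
  intro g f
  have h := hψ.integral_mul_wFun (L1w.toMw ω₁ f) g
  rw [L1w.toMw_apply_singleton, mul_zero, add_zero, L1w.integral_toMw] at h
  rw [integral_congr_ae (g := fun x => g x * wFun ψ (L1w.toMw ω₁ f : LocComplexMeasure) x), h]
  · simp only [mul_comm]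
  · filter_upwards [hψ.wOp_ae_eq (L1w.toMw ω₁ f)] with x hx
    rw [mul_comm, ← hx]
    rfl

end Admissible

end

/-! ### Uniqueness of V_ψ -/

section

variable {ψ : ℝ≥0 → ℝ} {ω ω₁ ω₂ : Weight} {C : ℝ≥0}

lemma Weight.measure_lt_top_of_isBounded (ω : Weight) {E : Set ℝ≥0} (hE : Bornology.IsBounded E) :
    ω.measure E < ∞ := by
  have hK : IsCompact (closure E) := Metric.isCompact_of_isClosed_isBounded isClosed_closure
    hE.closure
  refine (measure_mono subset_closure).trans_lt ?_
  rw [Weight.measure, withDensity_apply _ isClosed_closure.measurableSet]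
  have h := (ω.continuous.continuousOn.integrableOn_compact hK (μ := leb)).2
  refine lt_of_eq_of_lt (lintegral_congr fun x => ?_) h
  rw [Real.enorm_of_nonneg (ω.pos x).le, Weight.ennreal]

/-- Elements of `C₀(1/ω)` are determined by their pairing with `L¹(ω)`. -/
lemma C0w.ext_of_integral {g g' : C0w ω}
    (h : ∀ f : L1w ω, ∫ x, f x * g x ∂leb = ∫ x, f x * g' x ∂leb) : g = g' := by
  -- Indicators of compact sets lie in L¹(ω) and serve as test functions.
  have hset : ∀ E, IsCompact E → ∫ x in E, g x ∂leb = ∫ x in E, g' x ∂leb := by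
    intro E hE
    have hfin := (ω.measure_lt_top_of_isBounded hE.isBounded).ne
    have hind (g : C0w ω) : ∫ x, indicatorConstLp 1 hE.measurableSet hfin (1 : ℂ) x * g x ∂leb
        = ∫ x in E, g x ∂leb := by
      rw [← integral_indicator hE.measurableSet]
      refine integral_congr_ae ?_
      filter_upwards [ω.absolutelyContinuous.ae_le
        (indicatorConstLp_coeFn (p := 1) (hs := hE.measurableSet) (hμs := hfin) (c := (1 : ℂ)))]
        with x hx
      rw [hx]
      by_cases hxE : x ∈ E <;> simp [hxE]
    rw [← hind, ← hind, h]
  have hloc (g : C0w ω) : LocallyIntegrable g leb := g.continuous.locallyIntegrable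
  have hae : ∀ᵐ x ∂leb, g x - g' x = 0 := by
    refine ae_eq_zero_of_forall_setIntegral_isCompact_eq_zero' ((hloc g).sub (hloc g')) ?_
    intro E hE
    have hi (g : C0w ω) : IntegrableOn g E leb :=
      g.continuous.continuousOn.integrableOn_compact hE
    exact (integral_sub (hi g) (hi g')).trans (sub_eq_zero.2 (hset E hE))
  -- Lebesgue measure charges every nonempty open set, so continuous functions equal almost
  -- everywhere are equal.
  have heq : (g : ℝ≥0 → ℂ) = g' := (g.continuous.ae_eq_iff_eq leb g'.continuous).1
    (hae.mono fun x hx => sub_eq_zero.1 hx)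
  exact Subtype.ext heq

lemma Admissible.isAdjointRestriction_iff (hψ : Admissible ψ ω₁ ω₂ C)
    (V : C0w ω₂ →L[ℂ] C0w ω₁) : IsAdjointRestriction hψ.uOp V ↔ V = hψ.vOp := by
  refine ⟨fun h => ContinuousLinearMap.ext fun g => C0w.ext_of_integral fun f => ?_, ?_⟩
  · rw [← h g f, hψ.isAdjointRestriction g f]
  · rintro rfl
    exact hψ.isAdjointRestriction

/-! ### The formula for `U_ψ` -/

lemma map_mul_leb {x : ℝ≥0} (hx : 0 < x) : leb.map (fun t => t * x) = (x⁻¹ : ℝ≥0) • leb := by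
  have hm : Measurable fun t : ℝ≥0 => t * x := measurable_id.mul_const x
  ext E hE
  have h : leb.map (fun t => t * x) E * x = leb E := by
    rw [Measure.map_apply hm hE, ← lintegral_indicator_one hE, ← lintegral_leb_comp_mul hx,
      lintegral_mul_const' _ _ ENNReal.coe_ne_top, ← lintegral_indicator_one (hm hE)]
    rfl
  rw [Measure.smul_apply, ← h, ENNReal.smul_def, smul_eq_mul, mul_left_comm, ← ENNReal.coe_mul,
    inv_mul_cancel₀ hx.ne', ENNReal.coe_one, mul_one]

/-- For x > 0 the substitution s = tx turns ∫₀¹ f(tx) ψ(t) dt into W_ψ applied to f dx. Absolute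
convergence holds because f is integrable on bounded sets and ψ is bounded. -/
lemma Admissible.isHardyCesaro (hψ : Admissible ψ ω₁ ω₂ C) : IsHardyCesaro ψ hψ.uOp := by
  intro f
  filter_upwards [hψ.wOp_ae_eq (L1w.toMw ω₁ f), compl_mem_ae_iff.2 (measure_singleton (0 : ℝ≥0))]
    with x hx hx0
  have hx0 : 0 < x := pos_iff_ne_zero.2 hx0
  have hm : Measurable fun t : ℝ≥0 => t * x := measurable_id.mul_const x
  have hF : Measurable fun s : ℝ≥0 => f s * (ψ (s / x) : ℂ) :=
    (Lp.stronglyMeasurable f).measurable.mul (Complex.measurable_ofReal.comp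
      (hψ.continuous.measurable.comp (measurable_id.div_const x)))
  have hfi : IntegrableOn (fun s : ℝ≥0 => f s * (ψ (s / x) : ℂ)) (Ioc 0 x) leb := by
    obtain ⟨M, hM⟩ := hψ.bdd
    refine ((L1w.integrableOn f (Ioc 0 x) (Metric.isBounded_Ioc 0 x)).mul_bdd (c := M) ?_ ?_)
    · exact (Complex.measurable_ofReal.comp (hψ.continuous.measurable.comp
        (measurable_id.div_const x))).aestronglyMeasurable
    · refine Eventually.of_forall fun s => ?_
      rw [Complex.norm_real, Real.norm_of_nonneg (hψ.nonneg _)]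
      exact hM _
  have hpre : (fun t => t * x) ⁻¹' Ioc 0 x = Ioc 0 1 := by
    ext t
    simp [hx0, div_self hx0.ne']
  have hcomp : (fun t => f (t * x) * (ψ t : ℂ))
      = (fun s : ℝ≥0 => f s * (ψ (s / x) : ℂ)) ∘ fun t => t * x := by
    ext t
    simp [mul_div_cancel_right₀ _ hx0.ne']
  have hmap : (leb.restrict (Ioc 0 1)).map (fun t => t * x)
      = (x⁻¹ : ℝ≥0) • leb.restrict (Ioc 0 x) := by
    rw [← hpre, ← Measure.restrict_map hm measurableSet_Ioc, map_mul_leb hx0,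
      Measure.restrict_smul]
  constructor
  · rw [hcomp, IntegrableOn, ← integrable_map_measure hF.aestronglyMeasurable hm.aemeasurable, hmap]
    exact hfi.smul_measure_nnreal
  · rw [hcomp]
    simp only [Function.comp_def]
    rw [← integral_map (φ := fun t => t * x) hm.aemeasurable hF.aestronglyMeasurable, hmap,
      integral_smul_nnreal_measure, 
      Measure.restrict_congr_set Ioo_ae_eq_Ioc.symm]
    refine hx.trans ?_
    rw [hψ.wFun_eq (L1w.represents f), NNReal.smul_def, Complex.real_smul, ← integral_const_mul,
      ← integral_indicator measurableSet_Ioo]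
    refine integral_congr_ae (Eventually.of_forall fun s => ?_)
    by_cases hs : s ∈ Ioo 0 x
    · rw [indicator_of_mem hs]
      simp only [wKernel, if_pos (show 0 < s ∧ s < x from hs)]
      push_cast
      ring
    · rw [indicator_of_notMem hs]
      simp only [wKernel, if_neg (show ¬ (0 < s ∧ s < x) from hs), Complex.ofReal_zero, zero_mul]

lemma IsHardyCesaro.unique {U U' : L1w ω₁ →L[ℂ] L1w ω₂} (hU : IsHardyCesaro ψ U)
    (hU' : IsHardyCesaro ψ U') : U = U' := by
  refine ContinuousLinearMap.ext fun f => L1w.ext_leb ?_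
  filter_upwards [hU f, hU' f] with x hx hx'
  rw [hx.2, hx'.2]

lemma Admissible.isHardyCesaro_iff (hψ : Admissible ψ ω₁ ω₂ C) (U : L1w ω₁ →L[ℂ] L1w ω₂) :
    IsHardyCesaro ψ U ↔ U = hψ.uOp := by
  refine ⟨fun h => h.unique hψ.isHardyCesaro, ?_⟩
  rintro rfl
  exact hψ.isHardyCesaro

/-! ### Dependence on the values of `ψ` on `[0, 1]` only -/

variable {φ : ℝ≥0 → ℝ}

lemma isHardyCesaro_congr (h : EqOn ψ φ (Icc 0 1)) (U : L1w ω₁ →L[ℂ] L1w ω₂) :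
    IsHardyCesaro ψ U ↔ IsHardyCesaro φ U := by
  have h1 (f : L1w ω₁) (x : ℝ≥0) : EqOn (fun t => f (t * x) * (ψ t : ℂ))
      (fun t => f (t * x) * (φ t : ℂ)) (Ioc 0 1) := fun t ht => by
    simp only [h (Ioc_subset_Icc_self ht)]
  refine forall_congr' fun f => eventually_congr (Eventually.of_forall fun x => ?_)
  rw [integrableOn_congr_fun (h1 f x) measurableSet_Ioc,
    setIntegral_congr_fun measurableSet_Ioc (h1 f x)]

lemma wFun_congr (h : EqOn ψ φ (Icc 0 1)) (μ : LocComplexMeasure) : wFun ψ μ = wFun φ μ := by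
  ext x
  rw [wFun, wFun]
  congr 1
  refine VectorMeasure.integral_congr_ae ?_
  -- For s ≥ x the argument s/x may leave [0, 1], but the restricted measure has no variation
  -- outside (0, x).
  have h0 : (μ.restrict (Ioo 0 x) measurableSet_Ioo (Metric.isBounded_Ioo 0 x)).variation
      (Ioo 0 x)ᶜ = 0 := by
    rw [VectorMeasure.variation_apply_eq_zero measurableSet_Ioo.compl]
    intro t hts ht
    have : t ∩ Ioo 0 x = ∅ := (disjoint_left.2 fun y hy => hts hy).inter_eq
    simp [LocComplexMeasure.restrict, ht, this, μ.empty]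
  filter_upwards [compl_mem_ae_iff.2 h0] with s hs
  have hs : s ∈ Ioo 0 x := not_not.1 hs
  rw [h ⟨zero_le, (div_le_one (hs.1.trans hs.2)).2 hs.2.le⟩]

lemma setIntegral_div_congr (h : EqOn ψ φ (Icc 0 1)) :
    ∫ t in Ioc (0 : ℝ≥0) 1, ψ t / (t : ℝ) ∂leb = ∫ t in Ioc (0 : ℝ≥0) 1, φ t / (t : ℝ) ∂leb :=
  setIntegral_congr_fun measurableSet_Ioc fun t ht => by
    simp only [h (Ioc_subset_Icc_self ht)]

lemma ConditionC.exists_admissible (hC : ConditionC ψ ω₁ ω₂) (hψ : ContinuousOn ψ (Icc 0 1))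
    (h0 : ∀ t ∈ Icc (0 : ℝ≥0) 1, 0 ≤ ψ t) :
    ∃ φ C, Admissible φ ω₁ ω₂ C ∧ EqOn ψ φ (Icc 0 1) := by
  obtain ⟨C, hC⟩ := hC
  have hmem (t : ℝ≥0) : min t 1 ∈ Icc (0 : ℝ≥0) 1 := ⟨zero_le, min_le_right _ _⟩
  have heq : EqOn ψ (fun t => ψ (min t 1)) (Icc 0 1) := fun t ht => by
    simp only [min_eq_left ht.2]
  obtain ⟨M, hM⟩ := isCompact_Icc.exists_bound_of_continuousOn hψ
  -- Extending ψ by the constant ψ(1) keeps it continuous, non-negative and bounded. A negative C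
  -- may be truncated to 0, as `ENNReal.ofReal` already does this in condition (C).
  refine ⟨fun t => ψ (min t 1), C.toNNReal, ⟨?_, fun t => h0 _ (hmem t),
    ⟨M, fun t => (le_abs_self _).trans (hM _ (hmem t))⟩, fun s => ?_⟩, heq⟩
  · exact hψ.comp_continuous (continuous_id.min continuous_const) hmem
  · refine le_trans (le_of_eq ?_) ((hC s).trans_eq ?_)
    · refine setLIntegral_congr_fun measurableSet_Ioc fun t ht => ?_
      simp only [heq (Ioc_subset_Icc_self ht), Weight.ennreal,
        ENNReal.ofReal_mul (ω₂.pos _).le]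
    · rw [ENNReal.ofReal_mul' (ω₁.pos s).le]
      rfl

/-- Evaluation at {a} kills every f dx and equals 1 on δ_a. -/
lemma disjoint_range_toMw_span_dirac (ω : Weight) (a : ℝ≥0) :
    Disjoint (LinearMap.range (L1w.toMw ω)) (Submodule.span ℂ {Mw.dirac ω a}) := by
  rw [Submodule.disjoint_def]
  rintro _ ⟨f, rfl⟩ hf
  obtain ⟨c, hc⟩ := Submodule.mem_span_singleton.1 hf
  have h1 := congrArg (Mw.evalSingleton ω a) hc
  have h2 : Mw.evalSingleton ω a (Mw.dirac ω a) = 1 := by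
    simp [Mw.evalSingleton_apply, Mw.dirac, LocComplexMeasure.dirac]
  rw [map_smul, h2, Mw.evalSingleton_apply, L1w.toMw_apply_singleton, smul_eq_mul, mul_one] at h1
  rw [← hc, h1, zero_smul]

end

end HardyCesaro

theorem proposition3p3 (ψ : ℝ≥0 → ℝ) (hψ : ContinuousOn ψ (Icc 0 1))
    (hψ_nonneg : ∀ t ∈ Icc (0 : ℝ≥0) 1, 0 ≤ ψ t) (ω₁ ω₂ : Weight)
    (hC : ConditionC ψ ω₁ ω₂) :
    ∃ (U : L1w ω₁ →L[ℂ] L1w ω₂) (V : C0w ω₂ →L[ℂ] C0w ω₁) (Ubar : Mw ω₁ →L[ℂ] Mw ω₂),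
      -- `U` is the operator `U_ψ`, `V` is the operator `V_ψ`, and `Ubar` is the adjoint of `V`
      (∀ U' : L1w ω₁ →L[ℂ] L1w ω₂, IsHardyCesaro ψ U' ↔ U' = U) ∧
      (∀ V' : C0w ω₂ →L[ℂ] C0w ω₁, IsAdjointRestriction U V' ↔ V' = V) ∧
      (∀ T : Mw ω₁ →L[ℂ] Mw ω₂, IsMeasureAdjoint V T ↔ T = Ubar) ∧
      -- the formula for `Ubar`
      (∀ μ : Mw ω₁, ∃ hW : MemLp (wFun ψ μ) 1 ω₂.measure,
        Ubar μ = L1w.toMw ω₂ (hW.toLp (wFun ψ μ)) +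
          (((∫ t in Ioc (0 : ℝ≥0) 1, ψ t / (t : ℝ) ∂leb : ℝ) : ℂ) *
            (μ : LocComplexMeasure) {0}) • Mw.dirac ω₂ 0) ∧
      -- the range of `Ubar` lies in the direct sum of `L¹(ω₂)` and the multiples of `δ₀`
      Disjoint (LinearMap.range (L1w.toMw ω₂)) (Submodule.span ℂ {Mw.dirac ω₂ 0}) ∧
      (∀ μ : Mw ω₁, Ubar μ ∈
        LinearMap.range (L1w.toMw ω₂) ⊔ Submodule.span ℂ {Mw.dirac ω₂ 0}) ∧
      -- measures on `(0, ∞)` are mapped into `L¹(ω₂)`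
      (∀ μ : Mw ω₁, (μ : LocComplexMeasure) {0} = 0 →
        Ubar μ ∈ LinearMap.range (L1w.toMw ω₂)) := by
  obtain ⟨φ, C, hφ, heq⟩ := hC.exists_admissible hψ hψ_nonneg
  refine ⟨hφ.uOp, hφ.vOp, hφ.uBar, fun U' => ?_, hφ.isAdjointRestriction_iff,
    hφ.isMeasureAdjoint_iff, fun μ => ?_, disjoint_range_toMw_span_dirac ω₂ 0, fun μ => ?_,
    fun μ hμ => ?_⟩
  · rw [isHardyCesaro_congr heq, hφ.isHardyCesaro_iff]
  · simp only [wFun_congr heq, setIntegral_div_congr heq]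
    exact ⟨hφ.memLp_wFun μ, hφ.uBar_apply μ⟩
  · rw [hφ.uBar_apply]
    exact Submodule.add_mem_sup ⟨_, rfl⟩ (Submodule.smul_mem _ _ (Submodule.mem_span_singleton_self _))
  · rw [hφ.uBar_apply, hμ, mul_zero, zero_smul, add_zero]
    exact ⟨_, rfl⟩
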